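/- Let $L$ be a lattice of rank $n\ge 1$ and $L_{\mathbb R}=L\otimes\mathbb R$, $L_{\mathbb C}=L\otimes\mathbb C$, $L^*=\mathrm{Hom}(L,\mathbb Z)$, and $T=L_{\mathbb R}/L$. *Multi-fans.* A simplicial multi-fan $\Delta=(\Sigma,C,w^{\pm})$ in $L$ consists of a finite abstract simplicial complex $\Sigma$ (containing $\emptyset$), where $\Sigma^{(k)}$ denotes the set of simplices with $k$ vertices and $\Sigma^{(n)}\neq\emptyset$; a map $C$ assigning to $I\in\Sigma^{(k)}$ a $k$-dimensional simplicial rational cone $C(I)\subset L_{\mathbb R}$ whose faces are exactly the cones $C(J)$, $J\subseteq I$; and functions $w^{\pm}:\Sigma^{(n)}\to\mathbb Z_{\ge0}$. Put $w=w^+-w^-$. For $K\in\Sigma$, the projected multi-fan $\Delta_K$ has simplices $J\in\Sigma$ with $J\supseteq K$, cones $C_K(J)$ equal to the images of the $C(J)$ in $L_{\mathbb R}/\langle C(K)\rangle_{\mathbb R}$, and weights $w(J)$, $J\in\Sigma^{(n)}$, $J\supseteq K$. A vector is generic for a multi-fan if it lies on no linear subspace spanned by a cone of less than maximal dimension. $\Delta$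 is complete if for every $K\in\Sigma$ the integer $d_v=\sum_{J\in\Sigma^{(n)},\,J\supseteq K,\,v\in C_K(J)}w(J)$ is the same for all $v$ generic for $\Delta_K$. A set of edge vectors is $\mathcal V=\{v_i\in L\}_{i\in\Sigma^{(1)}}$, where $v_i$ generates the ray $C(\{i\})$ but need not be primitive. For $I\in\Sigma^{(n)}$ let $L_{I,\mathcal V}$ be the sublattice generated by $\{v_i\}_{i\in I}$, $H_I=L/L_{I,\mathcal V}$, $\{u_i^I\}_{i\in I}$ the basis of the dual space dual to $\{v_i\}_{i\in I}$, and $L_{\mathcal V}=\bigcap_{I\in\Sigma^{(n)}}L_{I,\mathcal V}$. Condition (P), the global type condition, says that $L_{I,\mathcal V}=L_{\mathcal V}$ for all $I\in\Sigma^{(n)}$. $\Delta$ is non-singular if, for every $I\in\Sigma^{(n)}$, the primitive generators of the rays $C(\{i\})$, $i\in I$, form a basis of $L$. *First Chern class.* Let $H_T^*(\Delta)=\mathbb Z[x_i : i\in\Sigma^{(1)}]/(\prod_{i\in J}x_i : J\notin\Sigma)$ with $\deg x_i=2$, and map $L^*=H^2(BT)$ to $H^2_T(\Delta)$ by $u\mapsto\sum_i\langle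 u,v_i\rangle x_i$. The first Chern class $c_1(\Delta,\mathcal V)$ is the image of $\sum_i x_i$ in $H_T^2(\Delta)/H^2(BT)$; divisibility by $N$ is meant in this group. For non-singular $\Delta$ one takes $\mathcal V$ to consist of the primitive generators and writes $c_1(\Delta)$. *Elliptic genus.* For $z,\sigma\in\mathbb C$ and $\mathrm{Im}\,\tau>0$ put $t=e^{2\pi\sqrt{-1}z}$, $q=e^{2\pi\sqrt{-1}\tau}$, $\zeta=e^{2\pi\sqrt{-1}\sigma}$, $$\Phi(z,\tau)=(t^{1/2}-t^{-1/2})\prod_{k\ge1}\frac{(1-tq^k)(1-t^{-1}q^k)}{(1-q^k)^2},\qquad \phi(z,\tau,\sigma)=\frac{\Phi(z+\sigma,\tau)}{\Phi(z,\tau)}.$$ The equivariant elliptic genus is the meromorphic function of $(W,\tau,\sigma)\in L_{\mathbb C}\times\mathbb H\times\mathbb C$ $$\varphi(\Delta,\mathcal V)=\sum_{I\in\Sigma^{(n)}}\frac{w(I)}{|H_I|}\sum_{h\in H_I}\prod_{i\in I}\phi(\langle u_i^I,-W-v(h)\rangle,\tau,\sigma),$$ where $v(h)\in L$ represents $h$;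 for a generic $v\in L_{\mathcal V}$ its restriction to $W=zv$ is the elliptic genus $\varphi^v(\Delta,\mathcal V;z,\tau,\sigma)$ along $v$. Equivalently, for fixed $\sigma$, $\varphi(\Delta,\mathcal V)$ is the power series in $q$ with coefficients in $\mathbb C[L^*]=R(T)\otimes\mathbb C$ such that, for every generic $v\in L_{\mathcal V}$, substituting $t^{\langle u,v\rangle}$ for the basis elements $t^u$ ($u\in L^*$) yields the $q$-expansion of $\varphi^v(\Delta,\mathcal V;z,\tau,\sigma)$. It is said to be of level $N$ when $\zeta^N=1$, $\zeta\ne1$. **Corollary.** Let $\Delta$ be a complete simplicial multi-fan in a lattice of rank $n\geq 1$, and let $N>1$ be an integer. 1. If $\mathcal V$ is a set of edge vectors satisfying (P) and $c_1(\Delta,\mathcal V)$ is divisible by $N$, then the equivariant elliptic genus $\varphi(\Delta,\mathcal V)$ of level $N$ vanishes identically: for every $\sigma$ with $\zeta^N=1$ and $\zeta\neq1$ it is zero as a meromorphic function on $L_{\mathbb C}\times\mathbb H$, the elliptic genus $\varphi^v(\Delta,\mathcal V;z,\tau,\sigma)$ vanishes identically for every generic $v\in L_{\mathcal V}$, and it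 is zero as a power series in $q$ over $\mathbb C[L^*]$. 2. In particular, if $\Delta$ is non-singular and $c_1(\Delta)$ is divisible by $N$, then the equivariant elliptic genus $\varphi(\Delta)$ of level $N$ vanishes identically in the same sense. -/

import Mathlib

open scoped TensorProduct

noncomputable section

/-! ## Simplicial multi-fans -/

/-- A simplicial multi-fan `(Σ, C, w⁺, w⁻)` in the lattice `L`, of dimension `n = rank L`.

`Σ` is an augmented (that is, containing `∅`) finite abstract simplicial complex whose vertex set
`Σ⁽¹⁾` is `V`; a simplex is recorded as its set of vertices, and `Σ⁽ᵏ⁾` consists of the simplices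
with `k` vertices.  `C` sends `I ∈ Σ⁽ᵏ⁾` to a `k`-dimensional simplicial rational cone in
`L_ℝ = ℝ ⊗ L`, and the faces of `C(I)` are exactly the cones `C(J)` with `J ⊆ I`; equivalently, the
cones `C(I)` are spanned by nonzero lattice vectors `ρ i` on the rays `C({i})`, for `i ∈ I`, and
these are linearly independent for every simplex `I`.
Values of `cone`, `wPos`, `wNeg` outside the simplices concerned play no role. -/
structure SimplicialMultiFan (L : Type*) [AddCommGroup L] [Module.Free ℤ L] [Module.Finite ℤ L]
    (V : Type*) [Fintype V] [DecidableEq V] where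
  faces : Finset (Finset V)
  empty_mem : ∅ ∈ faces
  down_closed : ∀ I ∈ faces, ∀ J, J ⊆ I → J ∈ faces
  singleton_mem : ∀ i, {i} ∈ faces
  exists_top : ∃ I ∈ faces, I.card = Module.finrank ℤ L
  cone : Finset V → PointedCone ℝ (ℝ ⊗[ℤ] L)
  exists_generators : ∃ ρ : V → L, ∀ I ∈ faces,
    LinearIndependent ℤ (fun i : I => ρ i) ∧
      cone I = PointedCone.hull ℝ ((fun i => (1 : ℝ) ⊗ₜ[ℤ] ρ i) '' (I : Set V))
  wPos : Finset V → ℕ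
  wNeg : Finset V → ℕ

namespace SimplicialMultiFan

variable {L : Type*} [AddCommGroup L] [Module.Free ℤ L] [Module.Finite ℤ L]
  {V : Type*} [Fintype V] [DecidableEq V] (Δ : SimplicialMultiFan L V)

/-- The set `Σ⁽ⁿ⁾` of simplices of maximal dimension, `n = rank L`. -/
def top : Finset (Finset V) := Δ.faces.filter (fun I => I.card = Module.finrank ℤ L)

/-- The weight `w(I) = w⁺(I) - w⁻(I)`. -/
def w (I : Finset V) : ℤ := (Δ.wPos I : ℤ) - (Δ.wNeg I : ℤ)

/-- A vector of `L_ℝ` is generic if it lies on no linear subspace spanned by a cone of `C(Σ)` of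
dimension less than `n`. -/
def IsGeneric (v : ℝ ⊗[ℤ] L) : Prop :=
  ∀ J ∈ Δ.faces, J.card < Module.finrank ℤ L →
    v ∉ Submodule.span ℝ (Δ.cone J : Set (ℝ ⊗[ℤ] L))

/-- The space `L^K_ℝ`: the quotient of `L_ℝ` by the linear subspace generated by `C(K)`. -/
abbrev ProjSpace (K : Finset V) : Type _ :=
  (ℝ ⊗[ℤ] L) ⧸ Submodule.span ℝ (Δ.cone K : Set (ℝ ⊗[ℤ] L))

/-- The cone `C_K(J)` of the projected multi-fan `Δ_K`: the image of `C(J)` in `L^K_ℝ`. -/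
def projCone (K J : Finset V) : PointedCone ℝ (Δ.ProjSpace K) :=
  (Δ.cone J).map (Submodule.mkQ (Submodule.span ℝ (Δ.cone K : Set (ℝ ⊗[ℤ] L))))

/-- Genericity with respect to the projected multi-fan `Δ_K`, of dimension `n - |K|`, whose
simplices are the `J ∈ Σ` with `K ⊆ J`, the cone `C_K(J)` having dimension `|J| - |K|`. -/
def IsProjGeneric (K : Finset V) (v : Δ.ProjSpace K) : Prop :=
  ∀ J ∈ Δ.faces, K ⊆ J → J.card < Module.finrank ℤ L →
    v ∉ Submodule.span ℝ (Δ.projCone K J : Set (Δ.ProjSpace K))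

open Classical in
/-- The integer `d_v` of the projected multi-fan `Δ_K`: the sum of the weights `w(J)` over the
simplices `J ∈ Σ⁽ⁿ⁾` containing `K` with `v ∈ C_K(J)`. -/
def projDegree (K : Finset V) (v : Δ.ProjSpace K) : ℤ :=
  ∑ J ∈ Δ.top.filter (fun J => K ⊆ J ∧ v ∈ Δ.projCone K J), Δ.w J

/-- The multi-fan is complete if, for every `K ∈ Σ` (including `K = ∅`, where `Δ_∅ = Δ`), the
projected multi-fan `Δ_K` is pre-complete: `d_v` does not depend on the generic vector `v`. -/
def IsComplete : Prop :=
  ∀ K ∈ Δ.faces, ∀ v v' : Δ.ProjSpace K,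
    Δ.IsProjGeneric K v → Δ.IsProjGeneric K v' → Δ.projDegree K v = Δ.projDegree K v'

/-- A set `𝒱 = {vᵢ}` of edge vectors: lattice vectors `vᵢ`, not necessarily primitive, such that
`vᵢ` generates the one-dimensional cone `C({i})`. -/
structure EdgeVectors where
  vec : V → L
  generates : ∀ i, Δ.cone {i} = PointedCone.hull ℝ {(1 : ℝ) ⊗ₜ[ℤ] vec i}

variable {Δ}

namespace EdgeVectors

variable (𝒱 : Δ.EdgeVectors)

/-- All the edge vectors are primitive lattice vectors. -/
def IsPrimitive : Prop :=
  ∀ (i : V) (m : ℤ) (x : L), 𝒱.vec i = m • x → IsUnit m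

/-- For a simplex `I`, the edge vectors `vᵢ`, `i ∈ I`, are linearly independent. -/
theorem linearIndependent {I : Finset V} (hI : I ∈ Δ.faces) :
    LinearIndependent ℤ (fun i : I => 𝒱.vec i) := by
  obtain ⟨ρ, hρ⟩ := Δ.exists_generators
  have key : ∀ i : V, ∃ a : ℝ, (1 : ℝ) ⊗ₜ[ℤ] ρ i = a • ((1 : ℝ) ⊗ₜ[ℤ] 𝒱.vec i) := by
    intro i
    have h1 := (hρ {i} (Δ.singleton_mem i)).2
    rw [𝒱.generates i] at h1
    have h2 : (1 : ℝ) ⊗ₜ[ℤ] ρ i ∈ PointedCone.hull ℝ {(1 : ℝ) ⊗ₜ[ℤ] 𝒱.vec i} := by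
      rw [h1]
      exact Submodule.subset_span ⟨i, by simp, rfl⟩
    obtain ⟨a, ha⟩ := Submodule.mem_span_singleton.1 h2
    exact ⟨a, ha.symm⟩
  choose a ha using key
  have hli : LinearIndependent ℝ (fun i : I => (1 : ℝ) ⊗ₜ[ℤ] ρ i) :=
    Module.Flat.linearIndependent_one_tmul (hρ I hI).1
  rw [Fintype.linearIndependent_iff]
  intro g hg i
  have hne : ∀ j : I, a j ≠ 0 := by
    intro j h0
    have := hli.ne_zero j
    rw [ha, h0, zero_smul] at this
    exact this rfl
  have h3 : ∑ j : I, ((g j : ℝ) * (a j)⁻¹) • ((1 : ℝ) ⊗ₜ[ℤ] ρ j) = 0 := by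
    have h4 : (1 : ℝ) ⊗ₜ[ℤ] (∑ j : I, g j • 𝒱.vec j) = 0 := by rw [hg, TensorProduct.tmul_zero]
    rw [TensorProduct.tmul_sum] at h4
    rw [← h4]
    refine Finset.sum_congr rfl fun j _ => ?_
    rw [ha, smul_smul, mul_assoc, inv_mul_cancel₀ (hne j), mul_one, TensorProduct.tmul_smul,
      Int.cast_smul_eq_zsmul]
  have h5 := Fintype.linearIndependent_iff.1 hli _ h3 i
  have h6 : (g i : ℝ) = 0 := by
    rcases mul_eq_zero.1 h5 with h | h
    · exact h
    · exact absurd (inv_eq_zero.1 h) (hne i)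
  exact_mod_cast h6

/-- The sublattice `L_{I,𝒱}` of `L` generated by the `vᵢ`, `i ∈ I`. -/
def lattice (I : Finset V) : Submodule ℤ L := Submodule.span ℤ (𝒱.vec '' (I : Set V))

/-- The lattice `L_𝒱`, the intersection of the `L_{I,𝒱}` over `I ∈ Σ⁽ⁿ⁾`. -/
def commonLattice : Submodule ℤ L := ⨅ I ∈ Δ.top, 𝒱.lattice I

/-- The global type condition: `L_{I,𝒱} = L_𝒱` for all `I ∈ Σ⁽ⁿ⁾`. -/
def IsGlobalType : Prop := ∀ I ∈ Δ.top, 𝒱.lattice I = 𝒱.commonLattice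

/-- For `I ∈ Σ⁽ⁿ⁾` the group `H_I = L / L_{I,𝒱}` is finite. -/
instance finite_quotient (I : Δ.top) : Finite (L ⧸ 𝒱.lattice I.1) := by
  obtain ⟨hI, hc⟩ := Finset.mem_filter.1 I.2
  apply Submodule.finiteQuotientOfFreeOfRankEq
  have h := finrank_span_eq_card (𝒱.linearIndependent hI)
  have hr : Set.range (fun i : I.1 => 𝒱.vec i) = 𝒱.vec '' (I.1 : Set V) := by
    ext x; simp
  rw [hr, Fintype.card_coe, hc] at h
  exact h

instance fintypeQuotient (I : Δ.top) : Fintype (L ⧸ 𝒱.lattice I.1) := Fintype.ofFinite _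

/-- For `I ∈ Σ⁽ⁿ⁾`, the vectors `vᵢ`, `i ∈ I`, as a basis of `L_ℂ = ℂ ⊗ L`. -/
def basis (I : Δ.top) : Module.Basis I.1 ℂ (ℂ ⊗[ℤ] L) :=
  have hli : LinearIndependent ℂ (fun i : I.1 => (1 : ℂ) ⊗ₜ[ℤ] 𝒱.vec i) :=
    Module.Flat.linearIndependent_one_tmul (𝒱.linearIndependent (Finset.mem_filter.1 I.2).1)
  Module.Basis.mk hli (hli.span_eq_top_of_card_eq_finrank' (by
    rw [Fintype.card_coe, (Finset.mem_filter.1 I.2).2, Module.finrank_baseChange])).ge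

/-- The dual basis vector `uᵢᴵ`, extended linearly to `L_ℂ`, so that `⟨uᵢᴵ, vⱼ⟩ = δᵢⱼ` for
`i, j ∈ I`. -/
def dualVec (I : Δ.top) (i : I.1) : (ℂ ⊗[ℤ] L) →ₗ[ℂ] ℂ := (𝒱.basis I).coord i

end EdgeVectors

variable (Δ) in
/-- The multi-fan is non-singular if, for every `I ∈ Σ⁽ⁿ⁾`, the primitive vectors generating the
rays `C({i})`, `i ∈ I`, form a basis of the lattice `L`. -/
def IsNonsingular : Prop :=
  ∃ 𝒱 : Δ.EdgeVectors, 𝒱.IsPrimitive ∧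
    ∀ I ∈ Δ.top, ∃ b : Module.Basis I ℤ L, ∀ i : I, b i = 𝒱.vec i

/-! ## Equivariant cohomology and the first Chern class -/

variable (Δ) in
/-- The ideal of `ℤ[xᵢ : i ∈ Σ⁽¹⁾]` generated by the monomials `∏_{i ∈ J} xᵢ` with `J ∉ Σ`. -/
def faceIdeal : Ideal (MvPolynomial V ℤ) :=
  Ideal.span {p | ∃ J : Finset V, J ∉ Δ.faces ∧ p = ∏ i ∈ J, MvPolynomial.X i}

variable (Δ) in
/-- The equivariant cohomology `H_T^*(Δ)`: the face ring of `Σ`. -/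
abbrev FaceRing : Type _ := MvPolynomial V ℤ ⧸ Δ.faceIdeal

variable (Δ) in
/-- The degree two part `H_T^2(Δ)` of the face ring, each generator `xᵢ` having degree two. -/
def H2T : Submodule ℤ Δ.FaceRing :=
  (MvPolynomial.homogeneousSubmodule V ℤ 1).map
    (Ideal.Quotient.mkₐ ℤ Δ.faceIdeal).toLinearMap

variable (Δ) in
/-- The class of `xᵢ` in `H_T^2(Δ)`. -/
def x (i : V) : Δ.H2T :=
  ⟨Ideal.Quotient.mk Δ.faceIdeal (MvPolynomial.X i),
    Submodule.mem_map_of_mem ((MvPolynomial.mem_homogeneousSubmodule 1 _).2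
      (MvPolynomial.isHomogeneous_X ℤ i))⟩

namespace EdgeVectors

variable (𝒱 : Δ.EdgeVectors)

/-- The map `L^* = H^2(BT) → H_T^2(Δ)`, `u ↦ ∑ᵢ ⟨u, vᵢ⟩ xᵢ`. -/
def fromBT : Module.Dual ℤ L →ₗ[ℤ] Δ.H2T :=
  ∑ i, (Module.Dual.eval ℤ L (𝒱.vec i)).smulRight (Δ.x i)

/-- The first Chern class `c₁(Δ, 𝒱)`: the image in `H_T^2(Δ) / H^2(BT)` of the equivariant first
Chern class `∑ᵢ xᵢ`. -/
def firstChern : Δ.H2T ⧸ LinearMap.range 𝒱.fromBT :=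
  Submodule.Quotient.mk (∑ i, Δ.x i)

/-- The first Chern class is divisible by `N` in `H_T^2(Δ) / H^2(BT)`. -/
def FirstChernDivisible (N : ℕ) : Prop :=
  ∃ y : Δ.H2T ⧸ LinearMap.range 𝒱.fromBT, 𝒱.firstChern = N • y

end EdgeVectors

end SimplicialMultiFan

/-! ## Theta functions and the elliptic genus -/

open Complex in
/-- `Φ(z, τ) = (t^{1/2} - t^{-1/2}) ∏_{k ≥ 1} (1 - t qᵏ)(1 - t⁻¹ qᵏ) / (1 - qᵏ)²`, where
`t^{1/2} = e^{πiz}` and `q = e^{2πiτ}`. -/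
def thetaPhi (z : ℂ) (τ : UpperHalfPlane) : ℂ :=
  (exp (Real.pi * I * z) - exp (-(Real.pi * I * z))) *
    ∏' k : ℕ,
      ((1 - exp (2 * Real.pi * I * z) * exp (2 * Real.pi * I * τ) ^ (k + 1)) *
          (1 - exp (-(2 * Real.pi * I * z)) * exp (2 * Real.pi * I * τ) ^ (k + 1))) /
        (1 - exp (2 * Real.pi * I * τ) ^ (k + 1)) ^ 2

/-- `φ(z, τ, σ) = Φ(z + σ, τ) / Φ(z, τ)`, a meromorphic function of `z` with poles at the zeros of
`Φ(z, τ)`. -/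
def ellipticPhi (z : ℂ) (τ : UpperHalfPlane) (σ : ℂ) : ℂ :=
  thetaPhi (z + σ) τ / thetaPhi z τ

namespace SimplicialMultiFan.EdgeVectors

variable {L : Type*} [AddCommGroup L] [Module.Free ℤ L] [Module.Finite ℤ L]
  {V : Type*} [Fintype V] [DecidableEq V] {Δ : SimplicialMultiFan L V} (𝒱 : Δ.EdgeVectors)

/-- The equivariant elliptic genus as a meromorphic function of `W ∈ L_ℂ`:
`∑_{I ∈ Σ⁽ⁿ⁾} w(I)/|H_I| ∑_{h ∈ H_I} ∏_{i ∈ I} φ(⟨uᵢᴵ, -W - v(h)⟩, τ, σ)`,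
with `v(h) ∈ L` a representative of `h`. -/
def ellipticGenusFun (W : ℂ ⊗[ℤ] L) (τ : UpperHalfPlane) (σ : ℂ) : ℂ :=
  ∑ I : Δ.top, ((Δ.w I.1 : ℂ) / (Nat.card (L ⧸ 𝒱.lattice I.1) : ℂ)) *
    ∑ h : L ⧸ 𝒱.lattice I.1, ∏ i : I.1,
      ellipticPhi (𝒱.dualVec I i (-W - (1 : ℂ) ⊗ₜ[ℤ] Quotient.out h)) τ σ

/-- `W` is not on a pole of any of the factors of the terms of the elliptic genus. -/
def IsRegular (W : ℂ ⊗[ℤ] L) (τ : UpperHalfPlane) : Prop :=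
  ∀ (I : Δ.top) (i : I.1) (x : L), thetaPhi (𝒱.dualVec I i (-W - (1 : ℂ) ⊗ₜ[ℤ] x)) τ ≠ 0

/-- The equivariant elliptic genus `φ^v(Δ, 𝒱; z, τ, σ)` along a vector `v`. -/
def ellipticGenusAlong (v : L) (z : ℂ) (τ : UpperHalfPlane) (σ : ℂ) : ℂ :=
  𝒱.ellipticGenusFun (z ⊗ₜ[ℤ] v) τ σ

/-- The value of `v^*(a)` at `t = e^{2πiz}`, where `a = ∑ a_u t^u` is an element of the complexified
character ring `ℂ[L^*]` of `T` and `v^*(t^u) = t^{⟨u, v⟩}`. -/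
def pullbackEval (v : L) (z : ℂ) : AddMonoidAlgebra ℂ (Module.Dual ℤ L) →ₐ[ℂ] ℂ :=
  AddMonoidAlgebra.lift ℂ ℂ (Module.Dual ℤ L)
    { toFun := fun u =>
        Complex.exp (2 * Real.pi * Complex.I * ((u.toAdd v : ℤ) : ℂ) * z)
      map_one' := by simp
      map_mul' := fun u u' => by
        rw [← Complex.exp_add]; simp; ring_nf }

/-- `Ψ`, a power series in `q` whose coefficients are complexified characters of `T`, is the
equivariant elliptic genus `φ(Δ, 𝒱; τ, σ)`: one has `v^*(Ψ) = φ^v(Δ, 𝒱)` for all generic `v ∈ L_𝒱`,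
that is, `v^*(Ψ)` is the expansion of `φ^v(Δ, 𝒱; z, τ, σ)` in powers of `q`, the characters being
evaluated at the points `t = e^{2πiz}` of the circle. -/
def IsEquivariantEllipticGenus (σ : ℂ)
    (Ψ : PowerSeries (AddMonoidAlgebra ℂ (Module.Dual ℤ L))) : Prop :=
  ∀ v ∈ 𝒱.commonLattice, Δ.IsGeneric ((1 : ℝ) ⊗ₜ[ℤ] v) →
    ∀ (τ : UpperHalfPlane) (z : ℝ), 𝒱.IsRegular ((z : ℂ) ⊗ₜ[ℤ] v) τ →
      HasSum (fun s : ℕ => pullbackEval v z (PowerSeries.coeff s Ψ) *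
          Complex.exp (2 * Real.pi * Complex.I * τ) ^ s)
        (𝒱.ellipticGenusAlong v z τ σ)

/-- The equivariant elliptic genus vanishes identically, in each of its three guises: as a
meromorphic function on `L_ℂ × ℍ`; along every generic vector `v ∈ L_𝒱`, as a meromorphic function
of `(z, τ)`; and as a power series in `q` with coefficients in the character ring of `T` (the zero
series is the equivariant elliptic genus, and the only one). -/
def EllipticGenusVanishes (σ : ℂ) : Prop :=
  (∀ (W : ℂ ⊗[ℤ] L) (τ : UpperHalfPlane), 𝒱.IsRegular W τ → 𝒱.ellipticGenusFun W τ σ = 0) ∧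
  (∀ v ∈ 𝒱.commonLattice, Δ.IsGeneric ((1 : ℝ) ⊗ₜ[ℤ] v) →
    ∀ (z : ℂ) (τ : UpperHalfPlane), 𝒱.IsRegular (z ⊗ₜ[ℤ] v) τ →
      𝒱.ellipticGenusAlong v z τ σ = 0) ∧
  (∀ Ψ : PowerSeries (AddMonoidAlgebra ℂ (Module.Dual ℤ L)),
    𝒱.IsEquivariantEllipticGenus σ Ψ ↔ Ψ = 0)

end SimplicialMultiFan.EdgeVectors

end

/-! Write ζ = e^{2πiσ}. The function φ(·, τ, σ) has period 1, multiplier ζ⁻¹ under translation by τ,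
and at most simple poles, all in ℤ + ℤτ. Under (P) every H_I is L/L_𝒱, so the genus is the average
over L/L_𝒱 of translates of G(X) = ∑_I w(I) ∏_{i ∈ I} φ(-⟨u_i^I, X⟩), and it suffices to kill G.
This is done by restricting G to a line W + zv and applying Liouville's theorem.

Divisibility of c₁ yields u ∈ L^* with ⟨u, v_i⟩ ≡ 1 mod N for all i; hence the coordinates of any
edge vector in any facet basis sum to 1 mod N. This congruence is used twice. It provides v ∈ L_𝒱
whose coordinates in every facet are nonzero and sum to 1 mod N (`exists_direction`), so that z ↦
G(W + zv) has multipliers 1 and ζ. It also makes the residues of the facets sharing a ridge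
proportional: at a pole they equal ±w(I) times a common quantity, the sign recording the side of the
ridge. Completeness of the one-dimensional projected multi-fans says that these signed weights sum
to zero (`facetSystem`), so the residues cancel (`sum_ridgeTerm_eq_zero`). The restriction of G is
then entire and bounded, hence a constant equal to ζ times itself, hence zero
(`eq_zero_of_quasiPeriodic`).

The residue computation requires that no two factors of a facet be singular together; the remaining
W are reached by continuity (`genus_eq_zero`). That zero is the only power series representing the
genus follows by evaluating at irrational multiples of a vector separating the characters involved.
-/

noncomputable section

/-! ## The theta function -/

section Theta

open Complex Filter Topology

/-- The infinite product `∏ (1 - t q^(k+1))`. -/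
def qProd (q t : ℂ) : ℂ := ∏' k : ℕ, (1 - t * q ^ (k + 1))

theorem summable_norm_mul_pow_succ {q : ℂ} (hq : ‖q‖ < 1) (t : ℂ) :
    Summable fun k : ℕ => ‖-(t * q ^ (k + 1))‖ := by
  simp only [norm_neg, norm_mul, norm_pow]
  exact ((summable_nat_add_iff 1).2 (summable_geometric_of_lt_one (norm_nonneg _) hq)).mul_left _

theorem multipliable_one_sub_mul_pow {q : ℂ} (hq : ‖q‖ < 1) (t : ℂ) :
    Multipliable fun k : ℕ => 1 - t * q ^ (k + 1) := by
  simpa only [sub_eq_add_neg] using multipliable_one_add_of_summable (summable_norm_mul_pow_succ hq t)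

theorem qProd_ne_zero {q t : ℂ} (hq : ‖q‖ < 1) (h : ∀ k : ℕ, 1 - t * q ^ (k + 1) ≠ 0) :
    qProd q t ≠ 0 := by
  have := tprod_one_add_ne_zero_of_summable (f := fun k : ℕ => -(t * q ^ (k + 1)))
    (fun i => by simpa only [sub_eq_add_neg] using h i) (summable_norm_mul_pow_succ hq t)
  simpa only [qProd, sub_eq_add_neg] using this

theorem qProd_shift {q : ℂ} (hq : ‖q‖ < 1) (t : ℂ) :
    qProd q t = (1 - t * q) * qProd q (t * q) := by
  have h : (fun k : ℕ => 1 - t * q ^ (k + 1 + 1)) = fun k : ℕ => 1 - t * q * q ^ (k + 1) := by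
    funext k; ring
  have h2 : Multipliable fun k : ℕ => 1 - t * q ^ (k + 1 + 1) := by
    rw [h]; exact multipliable_one_sub_mul_pow hq _
  unfold qProd
  rw [tprod_eq_zero_mul' (f := fun k : ℕ => 1 - t * q ^ (k + 1)) h2, h]
  simp

/-- On a ball the factors differ from 1 by terms of a fixed geometric series, so the product
converges locally uniformly. -/
theorem differentiable_qProd {q : ℂ} (hq : ‖q‖ < 1) : Differentiable ℂ (qProd q) := by
  intro t₀
  have hball : IsOpen (Metric.ball (0 : ℂ) (‖t₀‖ + 1)) := Metric.isOpen_ball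
  have hsum : Summable fun k : ℕ => (‖t₀‖ + 1) * ‖q‖ ^ (k + 1) :=
    ((summable_nat_add_iff 1).2 (summable_geometric_of_lt_one (norm_nonneg _) hq)).mul_left _
  have h := hsum.hasProdLocallyUniformlyOn_nat_one_add (R := ℂ)
    (f := fun (k : ℕ) (t : ℂ) => -(t * q ^ (k + 1))) hball
    (Eventually.of_forall fun n x hx => by
      rw [norm_neg, norm_mul, norm_pow]
      gcongr
      simpa using (Metric.mem_ball.1 hx).le)
    (fun n => by fun_prop)
  have hd := h.differentiableOn (Eventually.of_forall fun s => by
    simpa [Finset.prod_fn] using DifferentiableOn.finsetProd (fun _ _ ↦ by fun_prop)) hball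
  have := hd.differentiableAt (hball.mem_nhds (show t₀ ∈ Metric.ball (0 : ℂ) (‖t₀‖ + 1) by simp))
  have e : qProd q = fun t => ∏' k : ℕ, (1 + -(t * q ^ (k + 1))) := by
    funext t; simp only [qProd, sub_eq_add_neg]
  rw [e]
  exact this

/-- The nome `q = e^{2πiτ}`. -/
def nome (τ : UpperHalfPlane) : ℂ := exp (2 * Real.pi * I * τ)

theorem norm_nome_lt_one (τ : UpperHalfPlane) : ‖nome τ‖ < 1 :=
  UpperHalfPlane.norm_exp_two_pi_I_lt_one τ

theorem nome_ne_zero (τ : UpperHalfPlane) : nome τ ≠ 0 := exp_ne_zero _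

theorem one_sub_nome_pow_ne_zero (τ : UpperHalfPlane) (k : ℕ) :
    1 - 1 * nome τ ^ (k + 1) ≠ 0 := by
  rw [one_mul, sub_ne_zero]
  intro h
  have := congrArg norm h
  rw [norm_one, norm_pow] at this
  exact absurd this (pow_lt_one₀ (norm_nonneg _) (norm_nome_lt_one τ) (by simp)).ne'

/-- The infinite product in `thetaPhi`, in terms of `qProd`. -/
def thetaProd (z : ℂ) (τ : UpperHalfPlane) : ℂ :=
  qProd (nome τ) (exp (2 * Real.pi * I * z)) * qProd (nome τ) (exp (-(2 * Real.pi * I * z))) /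
    qProd (nome τ) 1 ^ 2

theorem qProd_nome_one_ne_zero (τ : UpperHalfPlane) : qProd (nome τ) 1 ≠ 0 :=
  qProd_ne_zero (norm_nome_lt_one τ) (one_sub_nome_pow_ne_zero τ)

theorem thetaPhi_eq (z : ℂ) (τ : UpperHalfPlane) :
    thetaPhi z τ = (exp (Real.pi * I * z) - exp (-(Real.pi * I * z))) * thetaProd z τ := by
  have hq := norm_nome_lt_one τ
  have h1 := (multipliable_one_sub_mul_pow hq (exp (2 * Real.pi * I * z))).hasProd
  have h2 := (multipliable_one_sub_mul_pow hq (exp (-(2 * Real.pi * I * z)))).hasProd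
  have h3 := (multipliable_one_sub_mul_pow hq 1).hasProd
  have h := (h1.mul h2).div₀ (h3.mul h3)
    (mul_ne_zero (qProd_nome_one_ne_zero τ) (qProd_nome_one_ne_zero τ))
  have h' := h.tprod_eq
  unfold thetaPhi thetaProd
  congr 1
  rw [sq, qProd, qProd, qProd, ← h']
  refine tprod_congr fun k => ?_
  simp only [nome, one_mul, sq]

theorem differentiable_thetaProd (τ : UpperHalfPlane) :
    Differentiable ℂ fun z => thetaProd z τ := by
  have h := differentiable_qProd (norm_nome_lt_one τ)
  unfold thetaProd
  refine (Differentiable.mul ?_ ?_).div_const _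
  · exact h.comp (by fun_prop)
  · exact h.comp (by fun_prop)

theorem differentiable_thetaPhi (τ : UpperHalfPlane) :
    Differentiable ℂ fun z => thetaPhi z τ := by
  have h := differentiable_thetaProd τ
  simp only [thetaPhi_eq]
  fun_prop

theorem thetaPhi_add_one (z : ℂ) (τ : UpperHalfPlane) :
    thetaPhi (z + 1) τ = -thetaPhi z τ := by
  have e1 : exp (Real.pi * I * (z + 1)) = -exp (Real.pi * I * z) := by
    rw [mul_add, mul_one, exp_add, exp_pi_mul_I]; ring
  have e2 : exp (2 * Real.pi * I * (z + 1)) = exp (2 * Real.pi * I * z) := by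
    rw [mul_add, mul_one, exp_add, exp_two_pi_mul_I]; ring
  simp only [thetaPhi_eq, thetaProd, exp_neg, e1, e2, inv_neg]
  ring

/-- Replacing t by tq removes the factor 1 - tq from one product and adds 1 - t⁻¹ to the other
(`qProd_shift`, twice); the prefactor t^{1/2} - t^{-1/2} absorbs both up to a monomial. -/
theorem thetaPhi_add_tau (z : ℂ) (τ : UpperHalfPlane) :
    thetaPhi (z + τ) τ =
      -(exp (-(Real.pi * I * τ)) * exp (-(2 * Real.pi * I * z))) * thetaPhi z τ := by
  have hq := norm_nome_lt_one τ
  set x := exp (Real.pi * I * z) with hx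
  set p := exp (Real.pi * I * τ) with hp
  have hx0 : x ≠ 0 := exp_ne_zero _
  have hp0 : p ≠ 0 := exp_ne_zero _
  have e1 : exp (Real.pi * I * (z + τ)) = x * p := by rw [mul_add, exp_add]
  have e2 : exp (2 * Real.pi * I * z) = x ^ 2 := by rw [hx, ← exp_nat_mul]; push_cast; ring_nf
  have e3 : nome τ = p ^ 2 := by rw [nome, hp, ← exp_nat_mul]; push_cast; ring_nf
  have e4 : exp (2 * Real.pi * I * (z + τ)) = x ^ 2 * nome τ := by
    rw [mul_add, exp_add, e2]; rfl
  have s1 := qProd_shift hq (x ^ 2)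
  have s2 := qProd_shift hq ((x ^ 2 * nome τ)⁻¹)
  have e5 : (x ^ 2 * nome τ)⁻¹ * nome τ = (x ^ 2)⁻¹ := by
    have := nome_ne_zero τ
    field_simp
  rw [e5] at s2
  simp only [thetaPhi_eq, thetaProd, exp_neg, e1, e2, e4, ← hx, ← hp]
  rw [s1, s2]
  have := qProd_nome_one_ne_zero τ
  rw [e3]
  rw [e3] at this
  field_simp
  ring

theorem exp_two_pi_eq_one_iff (w : ℂ) : exp (2 * Real.pi * I * w) = 1 ↔ ∃ m : ℤ, w = m := by
  rw [exp_eq_one_iff]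
  have h : (2 * Real.pi * I : ℂ) ≠ 0 := two_pi_I_ne_zero
  constructor
  · rintro ⟨m, hm⟩
    exact ⟨m, mul_left_cancel₀ h (by rw [hm]; ring)⟩
  · rintro ⟨m, rfl⟩
    exact ⟨m, by ring⟩

/-- Membership in the lattice `ℤ + ℤτ`. -/
def IsPeriod (τ : UpperHalfPlane) (z : ℂ) : Prop := ∃ m k : ℤ, z = m + k * τ

theorem isPeriod_of_one_sub_eq_zero {τ : UpperHalfPlane} {z : ℂ} {k : ℕ}
    (h : 1 - exp (2 * Real.pi * I * z) * nome τ ^ (k + 1) = 0) : IsPeriod τ z := by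
  have h1 : exp (2 * Real.pi * I * (z + (k + 1 : ℕ) * τ)) = 1 := by
    rw [mul_add, exp_add, sub_eq_zero.1 h, nome, ← exp_nat_mul]
    ring_nf
  obtain ⟨m, hm⟩ := (exp_two_pi_eq_one_iff _).1 h1
  exact ⟨m, -(k + 1 : ℕ), by rw [← hm]; push_cast; ring⟩

/-- An absolutely convergent product vanishes only if a factor does. This confines the poles of φ to
the periods. -/
theorem thetaPhi_eq_zero {τ : UpperHalfPlane} {z : ℂ} (h : thetaPhi z τ = 0) : IsPeriod τ z := by
  rw [thetaPhi_eq, thetaProd] at h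
  by_contra hz
  have hq := norm_nome_lt_one τ
  rcases mul_eq_zero.1 h with h | h
  · apply hz
    have h1 : exp (2 * Real.pi * I * z) = 1 := by
      have : (2 * Real.pi * I * z : ℂ) = Real.pi * I * z + Real.pi * I * z := by ring
      rw [this, exp_add]
      nth_rewrite 1 [sub_eq_zero.1 h]
      rw [← exp_add, neg_add_cancel, exp_zero]
    obtain ⟨m, hm⟩ := (exp_two_pi_eq_one_iff _).1 h1
    exact ⟨m, 0, by simp [hm]⟩
  · revert h
    refine div_ne_zero (mul_ne_zero (qProd_ne_zero hq fun k hk => ?_)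
      (qProd_ne_zero hq fun k hk => ?_)) (pow_ne_zero _ (qProd_nome_one_ne_zero τ))
    · exact hz (isPeriod_of_one_sub_eq_zero hk)
    · rw [← mul_neg] at hk
      obtain ⟨m, l, hml⟩ := isPeriod_of_one_sub_eq_zero hk
      exact hz ⟨-m, -l, by rw [← neg_neg z, hml]; push_cast; ring⟩

theorem thetaProd_zero (τ : UpperHalfPlane) : thetaProd 0 τ = 1 := by
  have := qProd_nome_one_ne_zero τ
  rw [thetaProd]
  simp only [mul_zero, neg_zero, exp_zero]
  field_simp

/-- The nonzero derivative shows that the zero at 0 is simple, so that φ has at most a simple pole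
there. -/
theorem hasDerivAt_thetaPhi_zero (τ : UpperHalfPlane) :
    HasDerivAt (fun z => thetaPhi z τ) (2 * Real.pi * I) 0 := by
  have h1 : HasDerivAt (fun z : ℂ => exp (Real.pi * I * z) - exp (-(Real.pi * I * z)))
      (2 * Real.pi * I) 0 := by
    have ha : HasDerivAt (fun z : ℂ => Real.pi * I * z) (Real.pi * I) 0 := by
      simpa using (hasDerivAt_id (0 : ℂ)).const_mul (Real.pi * I : ℂ)
    convert! ha.cexp.sub ha.neg.cexp using 1
    simp; ring
  have h2 := (differentiable_thetaProd τ 0).hasDerivAt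
  have h := h1.mul h2
  simp only [thetaPhi_eq]
  convert! h using 1
  simp [thetaProd_zero]

theorem thetaPhi_zero (τ : UpperHalfPlane) : thetaPhi 0 τ = 0 := by
  simp [thetaPhi_eq]

/-! ## The function `φ` -/

theorem ellipticPhi_add_one (z : ℂ) (τ : UpperHalfPlane) (σ : ℂ) :
    ellipticPhi (z + 1) τ σ = ellipticPhi z τ σ := by
  rw [ellipticPhi, ellipticPhi, add_right_comm, thetaPhi_add_one, thetaPhi_add_one, neg_div_neg_eq]

theorem ellipticPhi_add_tau (z : ℂ) (τ : UpperHalfPlane) (σ : ℂ) :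
    ellipticPhi (z + τ) τ σ = (exp (2 * Real.pi * I * σ))⁻¹ * ellipticPhi z τ σ := by
  rw [ellipticPhi, ellipticPhi, add_right_comm, thetaPhi_add_tau, thetaPhi_add_tau]
  have h1 := exp_ne_zero (-(Real.pi * I * τ))
  have h2 := exp_ne_zero (-(2 * Real.pi * I * z))
  have h3 : exp (-(2 * Real.pi * I * (z + σ))) =
      exp (-(2 * Real.pi * I * z)) * (exp (2 * Real.pi * I * σ))⁻¹ := by
    rw [← exp_neg, ← exp_add]; ring_nf
  rw [h3, mul_div_mul_comm, ]
  congr 1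
  field_simp

/-- Periods are subtracted because the genus evaluates φ at -⟨u, X⟩. The integer m leaves no trace,
since the signs of Φ cancel in the quotient. -/
theorem ellipticPhi_sub_period (z : ℂ) (τ : UpperHalfPlane) (σ : ℂ) (m k : ℤ) :
    ellipticPhi (z - (m + k * τ)) τ σ = exp (2 * Real.pi * I * σ) ^ k * ellipticPhi z τ σ := by
  have hζ := exp_ne_zero (2 * Real.pi * I * σ)
  have h1 : ∀ (z : ℂ) (m : ℤ), ellipticPhi (z - m) τ σ = ellipticPhi z τ σ := by
    intro z m
    induction m with
    | zero => simp
    | succ n ih =>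
      rw [← ih, ← ellipticPhi_add_one (z - ((n + 1 : ℤ) : ℂ))]; push_cast; ring_nf
    | pred n ih =>
      rw [← ih, ← ellipticPhi_add_one (z - ((-n : ℤ) : ℂ))]; push_cast; ring_nf
  have h2 : ∀ (z : ℂ) (k : ℤ), ellipticPhi (z - k * τ) τ σ =
      exp (2 * Real.pi * I * σ) ^ k * ellipticPhi z τ σ := by
    intro z k
    induction k with
    | zero => simp
    | succ n ih =>
      have := ellipticPhi_add_tau (z - ((n + 1 : ℤ) : ℂ) * τ) τ σ
      rw [show z - ((n + 1 : ℤ) : ℂ) * τ + τ = z - ((n : ℤ) : ℂ) * τ by push_cast; ring, ih] at this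
      rw [zpow_add_one₀ hζ, mul_right_comm, this]
      field_simp
    | pred n ih =>
      have := ellipticPhi_add_tau (z - ((-n : ℤ) : ℂ) * τ) τ σ
      rw [show z - ((-n : ℤ) : ℂ) * τ + τ = z - ((-n - 1 : ℤ) : ℂ) * τ by push_cast; ring, ih] at this
      rw [zpow_sub_one₀ hζ, this]
      ring
  rw [← sub_sub, h2, h1]

theorem differentiableAt_ellipticPhi {z : ℂ} {τ : UpperHalfPlane} (σ : ℂ)
    (h : thetaPhi z τ ≠ 0) : DifferentiableAt ℂ (fun z => ellipticPhi z τ σ) z := by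
  have hd := differentiable_thetaPhi τ
  unfold ellipticPhi
  exact DifferentiableAt.div (by fun_prop) (by fun_prop) h

theorem meromorphicAt_ellipticPhi (z : ℂ) (τ : UpperHalfPlane) (σ : ℂ) :
    MeromorphicAt (fun z => ellipticPhi z τ σ) z := by
  have hd := differentiable_thetaPhi τ
  unfold ellipticPhi
  refine MeromorphicAt.fun_div ?_ ?_
  · exact (Differentiable.analyticAt (f := fun z => thetaPhi (z + σ) τ) (by fun_prop) z).meromorphicAt
  · exact (hd.analyticAt z).meromorphicAt

theorem tendsto_mul_ellipticPhi (τ : UpperHalfPlane) (σ : ℂ) :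
    Tendsto (fun s => s * ellipticPhi s τ σ) (𝓝[≠] 0)
      (𝓝 (thetaPhi σ τ / (2 * Real.pi * I))) := by
  have h1 := hasDerivAt_iff_tendsto_slope.1 (hasDerivAt_thetaPhi_zero τ)
  have h2 : Tendsto (fun s => thetaPhi (s + σ) τ) (𝓝[≠] 0) (𝓝 (thetaPhi σ τ)) := by
    have hd := differentiable_thetaPhi τ
    have : Continuous fun s => thetaPhi (s + σ) τ := by
      have := hd.continuous
      fun_prop
    have := (this.tendsto 0).mono_left (nhdsWithin_le_nhds (s := {0}ᶜ))
    simpa using this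
  refine (h2.div h1 two_pi_I_ne_zero).congr fun s => ?_
  simp [slope_def_field, thetaPhi_zero, ellipticPhi, div_div_eq_mul_div]
  ring

/-- Near a period, `φ(-(p + (z - z₀) a))` has a simple pole at `z₀`. -/
theorem tendsto_sub_mul_ellipticPhi (τ : UpperHalfPlane) (σ : ℂ) {α a z₀ : ℂ} (ha : a ≠ 0)
    {m k : ℤ} (hp : α + z₀ * a = m + k * τ) :
    Tendsto (fun z => (z - z₀) * ellipticPhi (-(α + z * a)) τ σ) (𝓝[≠] z₀)
      (𝓝 (exp (2 * Real.pi * I * σ) ^ k * (-a⁻¹) * (thetaPhi σ τ / (2 * Real.pi * I)))) := by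
  have ht : Tendsto (fun z => -((z - z₀) * a)) (𝓝[≠] z₀) (𝓝[≠] 0) := by
    apply tendsto_nhdsWithin_of_tendsto_nhds_of_eventually_within
    · have : Continuous fun z => -((z - z₀) * a) := by fun_prop
      simpa using (this.tendsto z₀).mono_left (nhdsWithin_le_nhds (s := {z₀}ᶜ))
    · filter_upwards [self_mem_nhdsWithin] with z hz
      simpa [sub_eq_zero, ha] using hz
  have h := ((tendsto_mul_ellipticPhi τ σ).comp ht).const_mul
    (exp (2 * Real.pi * I * σ) ^ k * (-a⁻¹))
  refine h.congr fun z => ?_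
  have e : -(α + z * a) = -((z - z₀) * a) - (m + k * τ) := by rw [← hp]; ring
  rw [e, ellipticPhi_sub_period]
  simp only [Function.comp]
  field_simp

end Theta

/-! ## Quasi-periodic functions -/

section Liouville

open Complex Filter Topology

/-- A doubly quasi-periodic meromorphic function without poles, with a nontrivial multiplier of
absolute value one, vanishes. -/
theorem eq_zero_of_quasiPeriodic (τ : UpperHalfPlane) {ω : ℂ} (hω : ‖ω‖ = 1) (hω1 : ω ≠ 1)
    {g : ℂ → ℂ} (hg : ∀ z, MeromorphicAt g z)
    (hpole : ∀ z₀, Tendsto (fun z => (z - z₀) * g z) (𝓝[≠] z₀) (𝓝 0))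
    (h1 : ∀ z, g (z + 1) = g z) (hτ : ∀ z, g (z + τ) = ω * g z)
    {z : ℂ} (hz : ContinuousAt g z) : g z = 0 := by
  -- Riemann's removable singularity theorem: g is o(1/(z - z₀)) at every point, so it has a limit
  -- there.
  have hlim : ∀ z₀, Tendsto g (𝓝[≠] z₀) (𝓝 (limUnder (𝓝[≠] z₀) g)) := by
    intro z₀
    refine tendsto_limUnder_of_differentiable_on_punctured_nhds_of_isLittleO
      ((hg z₀).eventually_analyticAt.mono fun z hz => hz.differentiableAt) ?_
    rw [Asymptotics.isLittleO_iff_tendsto']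
    · have hc : Tendsto (fun z => (z - z₀) * g z₀) (𝓝[≠] z₀) (𝓝 0) := by
        have : Continuous fun z => (z - z₀) * g z₀ := by fun_prop
        simpa using (this.tendsto z₀).mono_left (nhdsWithin_le_nhds (s := {z₀}ᶜ))
      have := (hpole z₀).sub hc
      rw [sub_zero] at this
      refine this.congr fun z => ?_
      rw [div_inv_eq_mul]
      ring
    · filter_upwards [self_mem_nhdsWithin] with z hz h
      exact absurd (sub_eq_zero.1 (inv_eq_zero.1 h)) hz
  -- At a singular point the value of g may be an artefact of division by zero; h takes the limit
  -- instead and agrees with g wherever g is continuous.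
  set h : ℂ → ℂ := fun z₀ => limUnder (𝓝[≠] z₀) g with hh
  have hlim' : ∀ z₀ a, Tendsto g (𝓝[≠] z₀) (𝓝 a) → h z₀ = a := fun z₀ a ha =>
    tendsto_nhds_unique (hlim z₀) ha
  have hcont : ∀ z₀, ContinuousAt g z₀ → h z₀ = g z₀ := fun z₀ hz₀ =>
    hlim' z₀ _ (hz₀.tendsto.mono_left nhdsWithin_le_nhds)
  have hloc : ∀ z₀, ∀ᶠ z in 𝓝[≠] z₀, h =ᶠ[𝓝 z] g := by
    intro z₀
    filter_upwards [(hg z₀).eventually_analyticAt] with z hz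
    filter_upwards [hz.eventually_analyticAt] with y hy
    exact hcont y hy.continuousAt
  have hdiff : Differentiable ℂ h := by
    intro z₀
    refine (analyticAt_of_differentiable_on_punctured_nhds_of_continuousAt ?_ ?_).differentiableAt
    · filter_upwards [hloc z₀, (hg z₀).eventually_analyticAt] with z h1 h2
      exact (h1.differentiableAt_iff).2 h2.differentiableAt
    · rw [continuousAt_iff_punctured_nhds]
      refine (hlim z₀).congr' ?_
      filter_upwards [hloc z₀] with z h1
      exact h1.eq_of_nhds.symm
  have hshift : ∀ z₀ c : ℂ, Tendsto (fun z => z + c) (𝓝[≠] z₀) (𝓝[≠] (z₀ + c)) := by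
    intro z₀ c
    apply tendsto_nhdsWithin_of_tendsto_nhds_of_eventually_within
    · have : Continuous fun z => z + c := by fun_prop
      exact (this.tendsto z₀).mono_left nhdsWithin_le_nhds
    · filter_upwards [self_mem_nhdsWithin] with z hz
      simpa using hz
  have p1 : ∀ z, h (z + 1) = h z := by
    intro z
    symm
    refine hlim' z _ (((hlim (z + 1)).comp (hshift z 1)).congr fun y => ?_)
    exact h1 y
  have pτ : ∀ z, h (z + τ) = ω * h z := by
    intro z
    have a := (hlim (z + τ)).comp (hshift z τ)
    have b := (hlim z).const_mul ω
    exact tendsto_nhds_unique (a.congr fun y => hτ y) b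
  have n1 : Function.Periodic (fun z => ‖h z‖) 1 := fun z => by simp only [p1]
  have nτ : Function.Periodic (fun z => ‖h z‖) (τ : ℂ) := fun z => by
    simp only [pτ, norm_mul, hω, one_mul]
  -- Since |ω| = 1, the function |h| is doubly periodic, so its maximum on the compact fundamental
  -- parallelogram bounds it everywhere.
  have hbdd : ∃ C, ∀ z, ‖h z‖ ≤ C := by
    have hK : IsCompact ((fun p : ℝ × ℝ => (p.1 : ℂ) + p.2 * τ) ''
        (Set.Icc 0 1 ×ˢ Set.Icc 0 1)) :=
      (isCompact_Icc.prod isCompact_Icc).image (by fun_prop)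
    obtain ⟨C, hC⟩ := hK.exists_bound_of_continuousOn hdiff.continuous.continuousOn
    refine ⟨C, fun z => ?_⟩
    set y := z.im / τ.im with hy
    set x := z.re - y * τ.re with hx
    have him : τ.im ≠ 0 := τ.im_ne_zero
    have hz : z = (x : ℂ) + y * τ := by
      apply Complex.ext
      · simp [hx]
      · simp [hy, him]
    have e : z = (((Int.fract x : ℝ) : ℂ) + (Int.fract y : ℝ) * τ) + (⌊x⌋ : ℤ) * 1 + (⌊y⌋ : ℤ) * τ := by
      conv_lhs => rw [hz, ← Int.fract_add_floor x, ← Int.fract_add_floor y]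
      push_cast
      ring
    have e2 : ‖h z‖ = ‖h (((Int.fract x : ℝ) : ℂ) + (Int.fract y : ℝ) * τ)‖ := by
      conv_lhs => rw [e]
      exact ((nτ.int_mul ⌊y⌋) _).trans ((n1.int_mul ⌊x⌋) _)
    rw [e2]
    exact hC _ ⟨(Int.fract x, Int.fract y), ⟨⟨Int.fract_nonneg _, (Int.fract_lt_one _).le⟩,
      ⟨Int.fract_nonneg _, (Int.fract_lt_one _).le⟩⟩, rfl⟩
  obtain ⟨C, hC⟩ := hbdd
  have hconst := hdiff.apply_eq_apply_of_bounded
    (isBounded_iff_forall_norm_le.2 ⟨C, by rintro _ ⟨z, rfl⟩; exact hC z⟩)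
  have h3 : h z = ω * h z := by rw [← pτ]; exact hconst _ _
  have h4 : (1 - ω) * h z = 0 := by linear_combination h3
  rw [← hcont z hz]
  exact (mul_eq_zero.1 h4).resolve_left (sub_ne_zero.2 hω1.symm)

end Liouville

/-! ## Avoiding finitely many hyperplanes -/

/-- In an arithmetic progression `x + m y`, only finitely many terms are killed by one of finitely
many additive functions, provided none of them kills both `x` and `y`. -/
theorem exists_nat_forall_ne_zero {ι : Type*} (s : Finset ι) (a b : ι → ℂ)
    (h : ∀ k ∈ s, a k ≠ 0 ∨ b k ≠ 0) : ∃ m : ℕ, 0 < m ∧ ∀ k ∈ s, a k + m * b k ≠ 0 := by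
  classical
  have hfin : ({0} ∪ ⋃ k ∈ s, {m : ℕ | a k + m * b k = 0} : Set ℕ).Finite := by
    refine (Set.finite_singleton 0).union (s.finite_toSet.biUnion fun k hk => ?_)
    refine Set.Subsingleton.finite fun m hm n hn => ?_
    simp only [Set.mem_ofPred_eq] at hm hn
    have h1 : ((m : ℂ) - n) * b k = 0 := by linear_combination hm - hn
    rcases mul_eq_zero.1 h1 with h2 | h2
    · exact_mod_cast sub_eq_zero.1 h2
    · rw [h2, mul_zero, add_zero] at hm
      exact absurd h2 ((h k hk).resolve_left (not_not.2 hm))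
  obtain ⟨m, hm⟩ := hfin.exists_notMem
  simp only [Set.mem_union, Set.mem_singleton_iff, Set.mem_iUnion, Set.mem_ofPred_eq, not_or,
    not_exists] at hm
  exact ⟨m, Nat.pos_of_ne_zero hm.1, fun k hk => hm.2 k hk⟩

/-- Finitely many nonzero additive functions are simultaneously nonzero at some point. -/
theorem exists_forall_apply_ne_zero {ι G : Type*} [AddCommGroup G] (s : Finset ι) (f : ι → G →+ ℂ)
    (h : ∀ k ∈ s, ∃ x, f k x ≠ 0) : ∃ x, ∀ k ∈ s, f k x ≠ 0 := by
  classical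
  induction s using Finset.induction_on with
  | empty => exact ⟨0, by simp⟩
  | insert k s hk ih =>
    obtain ⟨x, hx⟩ := ih fun j hj => h j (Finset.mem_insert_of_mem hj)
    obtain ⟨y, hy⟩ := h k (Finset.mem_insert_self _ _)
    obtain ⟨m, -, hm⟩ := exists_nat_forall_ne_zero (insert k s) (fun j => f j y) (fun j => f j x)
      (by
        intro j hj
        rcases Finset.mem_insert.1 hj with rfl | hj
        · exact Or.inl hy
        · exact Or.inr (hx j hj))
    refine ⟨y + m • x, fun j hj => ?_⟩
    simpa using hm j hj

/-! ## Vanishing of sums of products of `φ` over facets -/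

section FacetSystem

open Complex Filter Topology

theorem prod_zpow_eq_zpow_sum {ι : Type*} {x : ℂ} (hx : x ≠ 0) (s : Finset ι) (a : ι → ℤ) :
    ∏ i ∈ s, x ^ a i = x ^ ∑ i ∈ s, a i := by
  classical
  induction s using Finset.induction_on with
  | empty => simp
  | insert i s hi ih => rw [Finset.prod_insert hi, Finset.sum_insert hi, zpow_add₀ hx, ih]

theorem IsPeriod.neg {τ : UpperHalfPlane} {z : ℂ} (h : IsPeriod τ z) : IsPeriod τ (-z) := by
  obtain ⟨m, k, rfl⟩ := h
  exact ⟨-m, -k, by push_cast; ring⟩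

theorem thetaPhi_neg_ne_zero {τ : UpperHalfPlane} {z : ℂ} (h : ¬ IsPeriod τ z) :
    thetaPhi (-z) τ ≠ 0 := fun h0 => h (by simpa using (thetaPhi_eq_zero h0).neg)

open Classical in
/-- The coefficient `-ζᵏ/a` governing the simple pole of `φ(-(z + (x - x₀) a))` at `x₀` when
`z = m + kτ`, and `0` when `z` is not a period. -/
def poleCoeff (τ : UpperHalfPlane) (σ z a : ℂ) : ℂ :=
  -- For z = m + kτ the quotient Im z / Im τ is exactly k; the floor merely reads it as an integer.
  if IsPeriod τ z then exp (2 * Real.pi * I * σ) ^ ⌊z.im / τ.im⌋ * (-a⁻¹) else 0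

theorem poleCoeff_period (τ : UpperHalfPlane) (σ a : ℂ) (m k : ℤ) :
    poleCoeff τ σ (m + k * τ) a = exp (2 * Real.pi * I * σ) ^ k * (-a⁻¹) := by
  have h : ((m : ℂ) + k * τ).im / τ.im = k := by
    have := τ.im_ne_zero
    simp [this]
  rw [poleCoeff, if_pos ⟨m, k, rfl⟩, h, Int.floor_intCast]

theorem poleCoeff_of_not {τ : UpperHalfPlane} {z : ℂ} (h : ¬ IsPeriod τ z) (σ a : ℂ) :
    poleCoeff τ σ z a = 0 := if_neg h

/-- For each facet `I`, a basis `(eᵢ)`, `i ∈ I`, with dual basis `(u_{I,i})`, all these bases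
generating the same lattice, whose vectors have coordinates summing to `1` modulo `N`. -/
structure FacetBases (V E : Type*) [DecidableEq V] [AddCommGroup E] [Module ℂ E] (N : ℕ) where
  top : Finset (Finset V)
  e : V → E
  u : Finset V → V → E →ₗ[ℂ] ℂ
  expand : ∀ I ∈ top, ∀ X, ∑ i ∈ I, u I i X • e i = X
  dual : ∀ I ∈ top, ∀ i ∈ I, ∀ j ∈ I, u I i (e j) = if i = j then 1 else 0
  integral : ∀ I ∈ top, ∀ i ∈ I, ∀ I' ∈ top, ∀ j ∈ I', ∃ m : ℤ, u I i (e j) = m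
  chern : ∀ I ∈ top, ∀ I' ∈ top, ∀ j ∈ I', ∃ k : ℤ, ∑ i ∈ I, u I i (e j) = 1 + N * k

/-- The data underlying the elliptic genus of a complete multi-fan of global type whose first Chern
class is divisible by `N`: facet bases with weights that are balanced along the ridges. -/
structure FacetSystem (V E : Type*) [DecidableEq V] [AddCommGroup E] [Module ℂ E] (N : ℕ)
    extends FacetBases V E N where
  w : Finset V → ℤ
  -- The number u_{I,i}(e_{i₀}) is ±1, according to whether I lies on the same side of the common
  -- ridge as I₀.
  balance : ∀ I₀ ∈ top, ∀ i₀ ∈ I₀,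
    ∑ p ∈ (top.sigma fun I => I) with p.1.erase p.2 = I₀.erase i₀,
      (w p.1 : ℂ) * u p.1 p.2 (e i₀) = 0

/-- Two bases differing in a single vector: expand Y in the basis of I₀ and apply the dual vectors
of I. The coefficient of e_{i₀} along e_i and its counterpart with the facets exchanged are integers
with product 1, hence ±1. -/
theorem FacetBases.exists_basis_change {V E : Type*} [DecidableEq V] [AddCommGroup E] [Module ℂ E]
    {N : ℕ} {S : FacetBases V E N} {I₀ I : Finset V} (hI₀ : I₀ ∈ S.top) (hI : I ∈ S.top) {i₀ i : V}
    (hi₀ : i₀ ∈ I₀) (hi : i ∈ I) (he : I.erase i = I₀.erase i₀) :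
    (∀ Y, S.u I i Y = S.u I i (S.e i₀) * S.u I₀ i₀ Y) ∧
    (∀ j ∈ I.erase i, ∀ Y, S.u I j Y = S.u I₀ j Y + S.u I j (S.e i₀) * S.u I₀ i₀ Y) ∧
    (S.u I i (S.e i₀) = 1 ∨ S.u I i (S.e i₀) = -1) := by
  have hmem : ∀ k ∈ I₀.erase i₀, k ∈ I ∧ k ≠ i := fun k hk => by
    rw [← he] at hk; exact ⟨Finset.mem_of_mem_erase hk, Finset.ne_of_mem_erase hk⟩
  have key : ∀ j Y, S.u I j Y = S.u I₀ i₀ Y * S.u I j (S.e i₀) +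
      ∑ k ∈ I₀.erase i₀, S.u I₀ k Y * S.u I j (S.e k) := by
    intro j Y
    conv_lhs => rw [← S.expand I₀ hI₀ Y, map_sum, ← Finset.add_sum_erase _ _ hi₀]
    simp
  have h1 : ∀ Y, S.u I i Y = S.u I i (S.e i₀) * S.u I₀ i₀ Y := by
    intro Y
    rw [key i Y, Finset.sum_eq_zero, add_zero, mul_comm]
    intro k hk
    rw [S.dual I hI i hi k (hmem k hk).1, if_neg (hmem k hk).2.symm, mul_zero]
  refine ⟨h1, fun j hj Y => ?_, ?_⟩
  · rw [key j Y, Finset.sum_eq_single j]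
    · rw [S.dual I hI j (Finset.mem_of_mem_erase hj) j (Finset.mem_of_mem_erase hj), if_pos rfl]
      ring
    · intro k hk hkj
      rw [S.dual I hI j (Finset.mem_of_mem_erase hj) k (hmem k hk).1, if_neg hkj.symm, mul_zero]
    · intro h
      exact absurd (he ▸ hj) h
  · obtain ⟨m, hm⟩ := S.integral I hI i hi I₀ hI₀ i₀ hi₀
    obtain ⟨n, hn⟩ := S.integral I₀ hI₀ i₀ hi₀ I hI i hi
    have h2 := h1 (S.e i)
    rw [S.dual I hI i hi i hi, if_pos rfl, hm, hn] at h2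
    have h3 : m * n = 1 := by exact_mod_cast h2.symm
    rw [hm]
    rcases Int.eq_one_or_neg_one_of_mul_eq_one h3 with rfl | rfl <;> simp

namespace FacetSystem

variable {V E : Type*} [DecidableEq V] [AddCommGroup E] [Module ℂ E] {N : ℕ}
  (S : FacetSystem V E N)

/-- The sum `∑_I w(I) ∏_{i ∈ I} φ(-⟨u_{I,i}, X⟩)`. -/
def genus (τ : UpperHalfPlane) (σ : ℂ) (X : E) : ℂ :=
  ∑ I ∈ S.top, (S.w I : ℂ) * ∏ i ∈ I, ellipticPhi (-(S.u I i X)) τ σ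

/-- The contribution of the ridge `I \ {i}` of the facet `I` to the residue along the line of
direction `v` at `X`. -/
def ridgeTerm (τ : UpperHalfPlane) (σ : ℂ) (X v : E) (I : Finset V) (i : V) : ℂ :=
  poleCoeff τ σ (S.u I i X) (S.u I i v) * ∏ j ∈ I.erase i, ellipticPhi (-(S.u I j X)) τ σ

variable {S}

/-- If u_{I₀,i₀}(X) = m + kτ, passing from I₀ to I shifts the argument of the j-th factor by the
period b_j(m + kτ), where b_j is the j-th coordinate of e_{i₀} in I. Together with the pole this
contributes ζ^{k ∑ b_j} = ζ^k, because ∑ b_j ≡ 1 mod N. All ridge terms are therefore b_i = ±1 times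
one common factor, and `balance` applies. -/
theorem sum_ridgeTerm_eq_zero {τ : UpperHalfPlane} {σ : ℂ}
    (hσ : exp (2 * Real.pi * I * σ) ^ N = 1) (X v : E) {I₀ : Finset V} (hI₀ : I₀ ∈ S.top)
    {i₀ : V} (hi₀ : i₀ ∈ I₀) :
    ∑ p ∈ (S.top.sigma fun I => I) with p.1.erase p.2 = I₀.erase i₀,
      (S.w p.1 : ℂ) * S.ridgeTerm τ σ X v p.1 p.2 = 0 := by
  have hζ : exp (2 * Real.pi * Complex.I * σ) ≠ 0 := exp_ne_zero _
  set ζ := exp (2 * Real.pi * Complex.I * σ) with hζdef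
  by_cases hper : IsPeriod τ (S.u I₀ i₀ X)
  · obtain ⟨m, k, hmk⟩ := hper
    have h : ∀ p ∈ (S.top.sigma fun I => I), p.1.erase p.2 = I₀.erase i₀ →
        S.ridgeTerm τ σ X v p.1 p.2 = S.u p.1 p.2 (S.e i₀) *
          (ζ ^ k * (-(S.u I₀ i₀ v)⁻¹) *
            ∏ j ∈ I₀.erase i₀, ellipticPhi (-(S.u I₀ j X)) τ σ) := by
      rintro ⟨I, i⟩ hp he
      obtain ⟨hI, hi⟩ := Finset.mem_sigma.1 hp
      dsimp only at hI hi he ⊢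
      obtain ⟨h1, h2, h3⟩ := S.exists_basis_change hI₀ hI hi₀ hi he
      have hint : ∀ j ∈ I, ∃ n : ℤ, S.u I j (S.e i₀) = n := fun j hj =>
        S.integral I hI j hj I₀ hI₀ i₀ hi₀
      choose! b hb using hint
      have hb3 : b i = 1 ∨ b i = -1 := by
        rw [hb i hi] at h3; exact_mod_cast h3
      obtain ⟨l, hl⟩ := S.chern I hI I₀ hI₀ i₀ hi₀
      have hsum : ∑ j ∈ I, b j = 1 + N * l := by
        rw [Finset.sum_congr rfl hb] at hl
        exact_mod_cast hl
      -- Here b_i = ±1 is its own inverse, so the factor 1/b_i coming from the slope of u_{I,i} may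
      -- be written as b_i.
      have hc : poleCoeff τ σ (S.u I i X) (S.u I i v) =
          ζ ^ (b i * k) * ((b i : ℂ) * (-(S.u I₀ i₀ v)⁻¹)) := by
        rw [h1 X, h1 v, hb i hi, hmk,
          show (b i : ℂ) * (m + k * τ) = ((b i * m : ℤ) : ℂ) + ((b i * k : ℤ) : ℂ) * τ by
            push_cast; ring, poleCoeff_period, mul_inv, ← hζdef]
        rcases hb3 with h | h <;> rw [h] <;> norm_num
      have hprod : ∏ j ∈ I.erase i, ellipticPhi (-(S.u I j X)) τ σ =
          ζ ^ ((∑ j ∈ I.erase i, b j) * k) *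
            ∏ j ∈ I₀.erase i₀, ellipticPhi (-(S.u I₀ j X)) τ σ := by
        rw [← he, Finset.sum_mul, ← prod_zpow_eq_zpow_sum hζ, ← Finset.prod_mul_distrib]
        refine Finset.prod_congr rfl fun j hj => ?_
        rw [h2 j hj X, hb j (Finset.mem_of_mem_erase hj), hmk,
          show -(S.u I₀ j X + b j * (m + k * τ)) =
            -(S.u I₀ j X) - (((b j * m : ℤ) : ℂ) + ((b j * k : ℤ) : ℂ) * τ) by
            push_cast; ring, ellipticPhi_sub_period]
      have hexp : ζ ^ (b i * k) * ζ ^ ((∑ j ∈ I.erase i, b j) * k) = ζ ^ k := by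
        rw [← zpow_add₀ hζ, ← add_mul, Finset.add_sum_erase _ _ hi, hsum, add_mul, one_mul,
          zpow_add₀ hζ, mul_assoc, zpow_mul, zpow_natCast, hσ, one_zpow, mul_one]
      rw [ridgeTerm, hc, hprod, hb i hi, ← hexp]
      ring
    have := S.balance I₀ hI₀ i₀ hi₀
    rw [Finset.sum_congr rfl fun p hp => by
      rw [h p (Finset.mem_filter.1 hp).1 (Finset.mem_filter.1 hp).2, ← mul_assoc],
      ← Finset.sum_mul, this, zero_mul]
  · refine Finset.sum_eq_zero ?_
    rintro ⟨I, i⟩ hp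
    obtain ⟨hp, he⟩ := Finset.mem_filter.1 hp
    obtain ⟨hI, hi⟩ := Finset.mem_sigma.1 hp
    obtain ⟨h1, -, h3⟩ := S.exists_basis_change hI₀ hI hi₀ hi he
    dsimp only at *
    have : ¬ IsPeriod τ (S.u I i X) := by
      intro h
      apply hper
      rcases h3 with h3 | h3
      · rwa [h1, h3, one_mul] at h
      · rw [h1, h3] at h
        simpa using h.neg
    rw [ridgeTerm, poleCoeff_of_not this, zero_mul, mul_zero]

theorem sum_sum_ridgeTerm_eq_zero {τ : UpperHalfPlane} {σ : ℂ}
    (hσ : exp (2 * Real.pi * I * σ) ^ N = 1) (X v : E) :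
    ∑ I ∈ S.top, (S.w I : ℂ) * ∑ i ∈ I, S.ridgeTerm τ σ X v I i = 0 := by
  simp only [Finset.mul_sum]
  rw [← Finset.sum_sigma (s := S.top) (t := fun I => I)
    (f := fun p => (S.w p.1 : ℂ) * S.ridgeTerm τ σ X v p.1 p.2),
    ← Finset.sum_fiberwise_of_maps_to (t := (S.top.sigma fun I => I).image
      fun p => p.1.erase p.2) (g := fun p => p.1.erase p.2)
      (fun p hp => Finset.mem_image_of_mem _ hp)]
  refine Finset.sum_eq_zero fun J hJ => ?_
  obtain ⟨⟨I₀, i₀⟩, hp, rfl⟩ := Finset.mem_image.1 hJ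
  obtain ⟨hI, hi⟩ := Finset.mem_sigma.1 hp
  exact sum_ridgeTerm_eq_zero hσ X v hI hi

/-- By `hgen` at most one factor is singular at z₀, so the residue is that factor's residue times
the values of the others; every other term of the sum has zero pole coefficient. -/
theorem tendsto_sub_mul_prod {τ : UpperHalfPlane} {σ : ℂ} {W v : E} {z₀ : ℂ} {I : Finset V}
    (hv : ∀ i ∈ I, S.u I i v ≠ 0)
    (hgen : ∀ i ∈ I, ∀ j ∈ I, i ≠ j → IsPeriod τ (S.u I i (W + z₀ • v)) →
      ¬ IsPeriod τ (S.u I j (W + z₀ • v))) :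
    Tendsto (fun z => (z - z₀) * ∏ i ∈ I, ellipticPhi (-(S.u I i (W + z • v))) τ σ) (𝓝[≠] z₀)
      (𝓝 ((∑ i ∈ I, S.ridgeTerm τ σ (W + z₀ • v) v I i) *
        (thetaPhi σ τ / (2 * Real.pi * Complex.I)))) := by
  have hreg : ∀ i, ¬ IsPeriod τ (S.u I i (W + z₀ • v)) →
      Tendsto (fun z => ellipticPhi (-(S.u I i (W + z • v))) τ σ) (𝓝[≠] z₀)
        (𝓝 (ellipticPhi (-(S.u I i (W + z₀ • v))) τ σ)) := by
    intro i hi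
    have h1 := (differentiableAt_ellipticPhi σ (thetaPhi_neg_ne_zero hi)).continuousAt
    have h2 : ContinuousAt (fun z : ℂ => -(S.u I i (W + z • v))) z₀ := by
      simp only [map_add, map_smul, smul_eq_mul]
      fun_prop
    exact (ContinuousAt.comp (f := fun z : ℂ => -(S.u I i (W + z • v))) h1 h2).tendsto.mono_left
      nhdsWithin_le_nhds
  by_cases hex : ∃ i ∈ I, IsPeriod τ (S.u I i (W + z₀ • v))
  · obtain ⟨i, hi, hper⟩ := hex
    obtain ⟨m, k, hmk⟩ := hper
    rw [Finset.sum_eq_single i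
      (fun j hj hji => by
        rw [ridgeTerm, poleCoeff_of_not (hgen i hi j hj hji.symm ⟨m, k, hmk⟩), zero_mul])
      (fun h => absurd hi h)]
    have h1 := tendsto_sub_mul_ellipticPhi τ σ (hv i hi) (α := S.u I i W) (z₀ := z₀) (m := m)
      (k := k) (by rw [← hmk]; simp)
    have h2 := tendsto_finsetProd (I.erase i) fun j hj =>
      hreg j (hgen i hi j (Finset.mem_of_mem_erase hj) (Finset.ne_of_mem_erase hj).symm ⟨m, k, hmk⟩)
    have h3 := h1.mul h2
    rw [ridgeTerm, hmk, poleCoeff_period]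
    convert! h3 using 2
    · rw [← Finset.mul_prod_erase _ _ hi]
      simp [mul_assoc]
    · ring
  · push Not at hex
    rw [Finset.sum_eq_zero fun i hi => by rw [ridgeTerm, poleCoeff_of_not (hex i hi), zero_mul],
      zero_mul]
    have h2 := tendsto_finsetProd I fun j hj => hreg j (hex j hj)
    have h3 : Tendsto (fun z => z - z₀) (𝓝[≠] z₀) (𝓝 0) := by
      have : Continuous fun z => z - z₀ := by fun_prop
      simpa using (this.tendsto z₀).mono_left (nhdsWithin_le_nhds (s := {z₀}ᶜ))
    simpa using h3.mul h2

/-- Continuity of the genus along an affine line at a regular point. -/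
theorem continuousAt_genus_line {τ : UpperHalfPlane} {W : E}
    (hW : ∀ I ∈ S.top, ∀ i ∈ I, thetaPhi (-(S.u I i W)) τ ≠ 0) (σ : ℂ) (v : E) :
    ContinuousAt (fun z : ℂ => S.genus τ σ (W + z • v)) 0 := by
  unfold genus
  refine tendsto_finsetSum _ fun I hI => ContinuousAt.mul continuousAt_const ?_
  refine tendsto_finsetProd _ fun i hi => ?_
  have h2 : ContinuousAt (fun z : ℂ => -(S.u I i (W + z • v))) 0 := by
    simp only [map_add, map_smul, smul_eq_mul]
    fun_prop
  refine ContinuousAt.comp (f := fun z : ℂ => -(S.u I i (W + z • v)))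
    (g := fun z => ellipticPhi z τ σ) ?_ h2
  refine (differentiableAt_ellipticPhi σ ?_).continuousAt
  simpa using hW I hI i hi

/-- Along the line, z ↦ z + 1 moves each argument by an integer, while z ↦ z + τ multiplies a
facet's product by ζ to the sum of the coordinates of v, that is by ζ. The residues cancel ridge by
ridge. -/
theorem genus_eq_zero_of_generic {τ : UpperHalfPlane} {σ : ℂ}
    (hσ : exp (2 * Real.pi * I * σ) ^ N = 1) (hσ1 : exp (2 * Real.pi * I * σ) ≠ 1)
    (hN : N ≠ 0) {W v : E}
    (hv : ∀ I ∈ S.top, ∀ i ∈ I, ∃ a : ℤ, S.u I i v = a ∧ a ≠ 0)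
    (hvN : ∀ I ∈ S.top, ∃ k : ℤ, ∑ i ∈ I, S.u I i v = 1 + N * k)
    (hW : ∀ I ∈ S.top, ∀ i ∈ I, thetaPhi (-(S.u I i W)) τ ≠ 0)
    (hgen : ∀ z₀ : ℂ, ∀ I ∈ S.top, ∀ i ∈ I, ∀ j ∈ I, i ≠ j →
      IsPeriod τ (S.u I i (W + z₀ • v)) → ¬ IsPeriod τ (S.u I j (W + z₀ • v))) :
    S.genus τ σ W = 0 := by
  have hζ : exp (2 * Real.pi * Complex.I * σ) ≠ 0 := exp_ne_zero _
  have h0 := eq_zero_of_quasiPeriodic τ (ω := exp (2 * Real.pi * Complex.I * σ))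
    (Complex.norm_eq_one_of_pow_eq_one hσ hN) hσ1
    (g := fun z => S.genus τ σ (W + z • v)) ?_ ?_ ?_ ?_ (continuousAt_genus_line hW σ v)
  · simpa using h0
  · intro z₀
    unfold genus
    refine MeromorphicAt.fun_sum fun I _ => MeromorphicAt.fun_mul (MeromorphicAt.const _ _) ?_
    refine MeromorphicAt.fun_prod fun i _ => ?_
    refine (meromorphicAt_ellipticPhi _ τ σ).comp_analyticAt
      (f := fun z => ellipticPhi z τ σ) (g := fun z : ℂ => -(S.u I i (W + z • v))) ?_
    simp only [map_add, map_smul, smul_eq_mul]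
    fun_prop
  · intro z₀
    have h := tendsto_finsetSum S.top fun I hI => (tendsto_sub_mul_prod (S := S) (σ := σ)
      (fun i hi => by
        obtain ⟨a, ha, ha0⟩ := hv I hI i hi
        rw [ha]; exact_mod_cast ha0) (hgen z₀ I hI)).const_mul (S.w I : ℂ)
    simp only [← mul_assoc] at h
    rw [← Finset.sum_mul, sum_sum_ridgeTerm_eq_zero hσ, zero_mul] at h
    refine h.congr fun z => ?_
    rw [genus, Finset.mul_sum]
    exact Finset.sum_congr rfl fun I _ => by ring
  · intro z
    refine Finset.sum_congr rfl fun I hI => ?_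
    congr 1
    refine Finset.prod_congr rfl fun i hi => ?_
    obtain ⟨a, ha, -⟩ := hv I hI i hi
    have := ellipticPhi_sub_period (-(S.u I i (W + z • v))) τ σ a 0
    rw [zpow_zero, one_mul] at this
    rw [← this]
    simp only [map_add, map_smul, smul_eq_mul, ha]
    push_cast
    ring_nf
  · intro z
    rw [genus, genus, Finset.mul_sum]
    refine Finset.sum_congr rfl fun I hI => ?_
    choose! a ha using hv I hI
    obtain ⟨k, hk⟩ := hvN I hI
    have hsum : ∑ i ∈ I, a i = 1 + N * k := by
      rw [Finset.sum_congr rfl fun i hi => (ha i hi).1] at hk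
      exact_mod_cast hk
    have hpow : ∏ i ∈ I, exp (2 * Real.pi * Complex.I * σ) ^ a i =
        exp (2 * Real.pi * Complex.I * σ) := by
      rw [prod_zpow_eq_zpow_sum hζ, hsum, zpow_add₀ hζ, zpow_mul, zpow_natCast, hσ,
        one_zpow, mul_one, zpow_one]
    conv_rhs => rw [mul_left_comm, ← hpow, ← Finset.prod_mul_distrib]
    congr 1
    refine Finset.prod_congr rfl fun i hi => ?_
    have := ellipticPhi_sub_period (-(S.u I i (W + z • v))) τ σ 0 (a i)
    rw [← this]
    simp only [map_add, map_smul, smul_eq_mul, (ha i hi).1]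
    push_cast
    ring_nf

/-- Two lattice conditions on a line through `W` in the direction `v`, moved in the direction `w`,
are simultaneously met for countably many translates only. -/
theorem countable_nongeneric (τ : UpperHalfPlane) (f g : E →ₗ[ℂ] ℂ) (W : E) {v w : E}
    (h : g v * f w - f v * g w ≠ 0) :
    {s : ℂ | ∃ z : ℂ, IsPeriod τ (f (W + s • w + z • v)) ∧
      IsPeriod τ (g (W + s • w + z • v))}.Countable := by
  -- The form g(v)f - f(v)g kills v, so z drops out and s is determined by four integers.
  refine (Set.countable_range fun q : (ℤ × ℤ) × (ℤ × ℤ) =>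
    (g v * (q.1.1 + q.1.2 * τ) - f v * (q.2.1 + q.2.2 * τ) - (g v * f W - f v * g W)) /
      (g v * f w - f v * g w)).mono ?_
  rintro s ⟨z, ⟨m, k, h1⟩, ⟨m', k', h2⟩⟩
  refine ⟨((m, k), (m', k')), ?_⟩
  dsimp only
  rw [div_eq_iff h, ← h1, ← h2]
  simp only [map_add, map_smul, smul_eq_mul]
  ring

/-- There is a lattice vector pairing nontrivially with all the `u_{I,i}` and whose coordinates sum
to `1` modulo `N` in every facet. -/
theorem exists_direction (hN : N ≠ 0) {I₀ : Finset V} (hI₀ : I₀ ∈ S.top) {i₀ : V} (hi₀ : i₀ ∈ I₀) :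
    ∃ v : E, (∀ I ∈ S.top, ∀ i ∈ I, ∃ a : ℤ, S.u I i v = a ∧ a ≠ 0) ∧
      ∀ I ∈ S.top, ∃ k : ℤ, ∑ i ∈ I, S.u I i v = 1 + N * k := by
  set B : Finset V := S.top.biUnion id with hB
  have hBmem : ∀ j ∈ B, ∃ I ∈ S.top, j ∈ I := fun j hj => by simpa [hB] using hj
  have hmemB : ∀ I ∈ S.top, ∀ j ∈ I, j ∈ B := fun I hI j hj => by
    simpa [hB] using ⟨I, hI, hj⟩
  let f : (Σ _ : Finset V, V) → (V → ℤ) →+ ℂ := fun p =>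
    AddMonoidHom.mk' (fun n => ∑ j ∈ B, (n j : ℂ) * S.u p.1 p.2 (S.e j)) fun a b => by
      simp [add_mul, Finset.sum_add_distrib]
  obtain ⟨n, hn⟩ := exists_forall_apply_ne_zero (S.top.sigma fun I => I) f (by
    rintro ⟨I, i⟩ hp
    obtain ⟨hI, hi⟩ := Finset.mem_sigma.1 hp
    refine ⟨Pi.single i 1, ?_⟩
    have hiB := hmemB I hI i hi
    simp only [f, AddMonoidHom.mk'_apply]
    rw [Finset.sum_eq_single i]
    · simp [S.dual I hI i hi i hi]
    · intro j _ hj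
      simp [hj]
    · exact fun h => absurd hiB h)
  set x : E := ∑ j ∈ B, (n j : ℂ) • S.e j with hx
  have hux : ∀ I i, S.u I i x = f ⟨I, i⟩ n := by
    intro I i
    simp [hx, f]
  have hxint : ∀ I ∈ S.top, ∀ i ∈ I, ∃ a : ℤ, S.u I i x = a := by
    intro I hI i hi
    have : ∀ j ∈ B, ∃ m : ℤ, S.u I i (S.e j) = m := fun j hj => by
      obtain ⟨I', hI', hj'⟩ := hBmem j hj
      exact S.integral I hI i hi I' hI' j hj'
    choose! m hm using this
    refine ⟨∑ j ∈ B, n j * m j, ?_⟩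
    rw [hx, map_sum]
    push_cast
    exact Finset.sum_congr rfl fun j hj => by rw [map_smul, hm j hj, smul_eq_mul]
  obtain ⟨m, -, hm⟩ := exists_nat_forall_ne_zero (S.top.sigma fun I => I)
    (fun p => S.u p.1 p.2 (S.e i₀)) (fun p => N * S.u p.1 p.2 x) (by
      rintro ⟨I, i⟩ hp
      right
      dsimp only
      rw [hux]
      exact mul_ne_zero (by exact_mod_cast hN) (hn _ hp))
  -- Adding mN times an integral vector preserves the coordinate sums mod N, and a suitable m makes
  -- every coordinate nonzero.
  refine ⟨S.e i₀ + (m * N : ℂ) • x, fun I hI i hi => ?_, fun I hI => ?_⟩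
  · obtain ⟨a, ha⟩ := S.integral I hI i hi I₀ hI₀ i₀ hi₀
    obtain ⟨b, hb⟩ := hxint I hI i hi
    have h1 := hm ⟨I, i⟩ (Finset.mem_sigma.2 ⟨hI, hi⟩)
    have h2 : S.u I i (S.e i₀ + (m * N : ℂ) • x) = ((a + m * N * b : ℤ) : ℂ) := by
      rw [map_add, map_smul, ha, hb, smul_eq_mul]
      push_cast
      ring
    refine ⟨_, h2, fun h0 => h1 ?_⟩
    dsimp only
    rw [h0, map_add, map_smul, smul_eq_mul] at h2
    rw [← mul_assoc, h2]
    simp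
  · obtain ⟨k, hk⟩ := S.chern I hI I₀ hI₀ i₀ hi₀
    choose! b hb using hxint I hI
    refine ⟨k + m * ∑ i ∈ I, b i, ?_⟩
    simp only [map_add, map_smul, smul_eq_mul, Finset.sum_add_distrib, hk, ← Finset.mul_sum]
    rw [Finset.sum_congr rfl hb]
    push_cast
    ring

/-- The genus of level `N` vanishes at all regular points. -/
theorem genus_eq_zero {τ : UpperHalfPlane} {σ : ℂ} (hN : N ≠ 0)
    (hσ : exp (2 * Real.pi * I * σ) ^ N = 1) (hσ1 : exp (2 * Real.pi * I * σ) ≠ 1)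
    (hne : ∃ I ∈ S.top, I.Nonempty) {W : E}
    (hW : ∀ I ∈ S.top, ∀ i ∈ I, thetaPhi (-(S.u I i W)) τ ≠ 0) :
    S.genus τ σ W = 0 := by
  obtain ⟨I₀, hI₀, i₀, hi₀⟩ := hne
  obtain ⟨v, hv, hvN⟩ := exists_direction hN hI₀ hi₀
  set T : Finset (Σ I : Finset V, V × V) :=
    S.top.sigma fun I => (I ×ˢ I).filter fun p => p.1 ≠ p.2 with hT
  have hTmem : ∀ I i j, (⟨I, i, j⟩ : Σ I : Finset V, V × V) ∈ T ↔
      I ∈ S.top ∧ (i ∈ I ∧ j ∈ I) ∧ i ≠ j := by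
    intro I i j
    simp [hT]
  -- The determinants of (u_{I,i}, u_{I,j}) on (v, w) must all be nonzero, so that moving in the
  -- direction w separates the poles of distinct factors.
  obtain ⟨w, hw⟩ := exists_forall_apply_ne_zero T
    (fun p => (S.u p.1 p.2.2 v • S.u p.1 p.2.1 - S.u p.1 p.2.1 v • S.u p.1 p.2.2).toAddMonoidHom)
    (by
      rintro ⟨I, i, j⟩ hp
      obtain ⟨hI, ⟨hi, hj⟩, hij⟩ := (hTmem I i j).1 hp
      obtain ⟨a, ha, ha0⟩ := hv I hI j hj
      refine ⟨S.e i, ?_⟩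
      simp only [LinearMap.toAddMonoidHom_coe, LinearMap.sub_apply, LinearMap.smul_apply,
        smul_eq_mul, S.dual I hI i hi i hi, S.dual I hI j hj i hi, if_neg hij.symm, ha]
      simpa using ha0)
  set bad : Set ℂ := ⋃ p ∈ T, {s : ℂ | ∃ z : ℂ, IsPeriod τ (S.u p.1 p.2.1 (W + s • w + z • v)) ∧
      IsPeriod τ (S.u p.1 p.2.2 (W + s • w + z • v))} with hbad
  have hcount : bad.Countable := by
    refine T.countable_toSet.biUnion fun p hp => countable_nongeneric τ _ _ W ?_
    simpa using hw p hp
  -- Good values of s accumulate at 0, so the vanishing at W + sw passes to W by continuity.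
  have hdense : Dense badᶜ := hcount.dense_compl ℂ
  have hcont := continuousAt_genus_line hW σ w
  have hreg : ∀ᶠ s : ℂ in 𝓝 0, ∀ I ∈ S.top, ∀ i ∈ I, thetaPhi (-(S.u I i (W + s • w))) τ ≠ 0 := by
    rw [Filter.eventually_all_finset]
    intro I hI
    rw [Filter.eventually_all_finset]
    intro i hi
    have hc : Continuous fun s : ℂ => thetaPhi (-(S.u I i (W + s • w))) τ := by
      have := (differentiable_thetaPhi τ).continuous
      simp only [map_add, map_smul, smul_eq_mul]
      fun_prop
    refine (hc.tendsto 0).eventually_ne ?_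
    simpa using hW I hI i hi
  have hzero : ∀ᶠ s in 𝓝[badᶜ] (0 : ℂ), S.genus τ σ (W + s • w) = 0 := by
    filter_upwards [nhdsWithin_le_nhds hreg, self_mem_nhdsWithin] with s hs hsb
    refine genus_eq_zero_of_generic hσ hσ1 hN hv hvN hs ?_
    intro z₀ I hI i hi j hj hij h1 h2
    exact hsb (Set.mem_biUnion ((hTmem I i j).2 ⟨hI, ⟨hi, hj⟩, hij⟩) ⟨z₀, h1, h2⟩)
  have : (𝓝[badᶜ] (0 : ℂ)).NeBot := mem_closure_iff_nhdsWithin_neBot.1 (hdense 0)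
  have h := tendsto_nhds_unique (hcont.tendsto.mono_left (nhdsWithin_le_nhds (s := badᶜ)))
    ((tendsto_congr' hzero).2 tendsto_const_nhds)
  simpa using h

end FacetSystem

end FacetSystem

/-! ### From a multi-fan to facet bases: face ring, first Chern class, dual coordinates -/

namespace SimplicialMultiFan

variable {L : Type*} [AddCommGroup L] [Module.Free ℤ L] [Module.Finite ℤ L]
  {V : Type*} [Fintype V] [DecidableEq V] {Δ : SimplicialMultiFan L V}

theorem mem_top {I : Finset V} : I ∈ Δ.top ↔ I ∈ Δ.faces ∧ I.card = Module.finrank ℤ L :=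
  Finset.mem_filter

variable (Δ) in
/-- The coefficient of `xᵢ`, as a linear form on the face ring. -/
def faceCoeff (i : V) : Δ.FaceRing →+ ℤ :=
  (Polynomial.lcoeff ℤ 1).toAddMonoidHom.comp
    (Ideal.Quotient.lift Δ.faceIdeal
      (MvPolynomial.eval₂Hom (Int.castRingHom (Polynomial ℤ))
        fun j => if j = i then Polynomial.X else 0) (by
        intro p hp
        rw [← RingHom.mem_ker]
        refine (Ideal.span_le.2 ?_ : Δ.faceIdeal ≤ _) hp
        rintro _ ⟨J, hJ, rfl⟩
        rw [SetLike.mem_coe, RingHom.mem_ker, map_prod]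
        -- A non-face is not contained in {i}, so its monomial has a variable that is sent to 0.
        obtain ⟨j, hj, hji⟩ : ∃ j ∈ J, j ≠ i := by
          by_contra! h
          exact hJ (Δ.down_closed {i} (Δ.singleton_mem i) J fun j hj => by simp [h j hj])
        exact Finset.prod_eq_zero hj (by simp [hji]))).toAddMonoidHom

theorem faceCoeff_x (i j : V) : Δ.faceCoeff i (Δ.x j : Δ.FaceRing) = if j = i then 1 else 0 := by
  by_cases h : j = i <;> simp [faceCoeff, x, h]

namespace EdgeVectors

variable (𝒱 : Δ.EdgeVectors)

/-- If the first Chern class is divisible by `N`, some `u ∈ L^*` takes values congruent to `1`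
modulo `N` at all edge vectors. -/
theorem exists_dual_of_firstChernDivisible {N : ℕ} (h : 𝒱.FirstChernDivisible N) :
    ∃ (u : Module.Dual ℤ L) (y : V → ℤ), ∀ i, u (𝒱.vec i) = 1 + N * y i := by
  obtain ⟨y, hy⟩ := h
  obtain ⟨y, rfl⟩ := Submodule.Quotient.mk_surjective _ y
  rw [firstChern, ← Submodule.Quotient.mk_smul, Submodule.Quotient.eq] at hy
  -- The image of u is ∑ xᵢ - N y; comparing coefficients of xᵢ gives the congruence, with the sign
  -- of y reversed.
  obtain ⟨u, hu⟩ := hy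
  refine ⟨u, fun i => -Δ.faceCoeff i (y : Δ.FaceRing), fun i => ?_⟩
  have h1 := congrArg (fun z : Δ.H2T => Δ.faceCoeff i (z : Δ.FaceRing)) hu
  simp only [fromBT, LinearMap.sum_apply, LinearMap.smulRight_apply, Module.Dual.eval_apply,
    AddSubgroupClass.coe_sub, Submodule.coe_sum, Submodule.coe_smul, map_sub, map_sum, map_zsmul,
    faceCoeff_x] at h1
  simp at h1
  rw [h1, ← nsmul_eq_mul, map_nsmul, nsmul_eq_mul]
  ring

/-- The linear forms `uᵢᴵ` on `L_ℂ`, extended by zero to all pairs `(I, i)`. -/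
def coord (I : Finset V) (i : V) : (ℂ ⊗[ℤ] L) →ₗ[ℂ] ℂ :=
  if h : I ∈ Δ.top ∧ i ∈ I then 𝒱.dualVec ⟨I, h.1⟩ ⟨i, h.2⟩ else 0

theorem coord_coe (I : Δ.top) (i : I.1) : 𝒱.coord I.1 i.1 = 𝒱.dualVec I i := by
  rw [coord, dif_pos ⟨I.2, i.2⟩]

theorem basis_apply (I : Δ.top) (i : I.1) : 𝒱.basis I i = (1 : ℂ) ⊗ₜ[ℤ] 𝒱.vec i := by
  simp [basis]

theorem sum_coord_smul {I : Finset V} (hI : I ∈ Δ.top) (X : ℂ ⊗[ℤ] L) :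
    ∑ i ∈ I, 𝒱.coord I i X • ((1 : ℂ) ⊗ₜ[ℤ] 𝒱.vec i) = X := by
  rw [← Finset.sum_coe_sort I fun i => 𝒱.coord I i X • ((1 : ℂ) ⊗ₜ[ℤ] 𝒱.vec i)]
  conv_rhs => rw [← (𝒱.basis ⟨I, hI⟩).sum_repr X]
  refine Finset.sum_congr rfl fun i _ => ?_
  rw [𝒱.coord_coe ⟨I, hI⟩ i, basis_apply]
  rfl

theorem coord_vec {I : Finset V} (hI : I ∈ Δ.top) {i j : V} (hi : i ∈ I) (hj : j ∈ I) :
    𝒱.coord I i ((1 : ℂ) ⊗ₜ[ℤ] 𝒱.vec j) = if i = j then 1 else 0 := by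
  rw [𝒱.coord_coe ⟨I, hI⟩ ⟨i, hi⟩, ← 𝒱.basis_apply ⟨I, hI⟩ ⟨j, hj⟩, dualVec,
    Module.Basis.coord_apply, Module.Basis.repr_self, Finsupp.single_apply]
  simp [Subtype.ext_iff, eq_comm]

theorem exists_int_of_mem_lattice {I : Finset V} {x : L} (hx : x ∈ 𝒱.lattice I) :
    ∃ m : V → ℤ, x = ∑ i ∈ I, m i • 𝒱.vec i := by
  classical
  induction hx using Submodule.span_induction with
  | mem x hx =>
    obtain ⟨i, hi, rfl⟩ := hx
    refine ⟨Pi.single i 1, ?_⟩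
    rw [Finset.sum_eq_single i]
    · simp
    · intro j _ hj
      simp [hj]
    · intro h
      exact absurd hi h
  | zero => exact ⟨0, by simp⟩
  | add x y _ _ hx hy =>
    obtain ⟨m, rfl⟩ := hx
    obtain ⟨n, rfl⟩ := hy
    exact ⟨m + n, by simp [add_smul, Finset.sum_add_distrib]⟩
  | smul a x _ hx =>
    obtain ⟨m, rfl⟩ := hx
    exact ⟨a • m, by simp [Finset.smul_sum, mul_smul]⟩

theorem coord_sum_smul_vec {I : Finset V} (hI : I ∈ Δ.top) {i : V} (hi : i ∈ I) (m : V → ℤ) :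
    𝒱.coord I i ((1 : ℂ) ⊗ₜ[ℤ] ∑ j ∈ I, m j • 𝒱.vec j) = m i := by
  rw [TensorProduct.tmul_sum, map_sum, Finset.sum_eq_single i]
  · rw [TensorProduct.tmul_smul, map_zsmul, 𝒱.coord_vec hI hi hi]
    simp
  · intro j hj hji
    rw [TensorProduct.tmul_smul, map_zsmul, 𝒱.coord_vec hI hi hj, if_neg hji.symm, smul_zero]
  · exact fun h => absurd hi h

theorem vec_mem_lattice (h𝒱 : 𝒱.IsGlobalType) {I I' : Finset V} (hI : I ∈ Δ.top)
    (hI' : I' ∈ Δ.top) {j : V} (hj : j ∈ I') : 𝒱.vec j ∈ 𝒱.lattice I := by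
  rw [h𝒱 I hI, ← h𝒱 I' hI']
  exact Submodule.subset_span ⟨j, hj, rfl⟩

/-- The facet bases given by the edge vectors. -/
def facetBases (h𝒱 : 𝒱.IsGlobalType) {N : ℕ} (hc : 𝒱.FirstChernDivisible N) :
    FacetBases V (ℂ ⊗[ℤ] L) N where
  top := Δ.top
  e i := (1 : ℂ) ⊗ₜ[ℤ] 𝒱.vec i
  u := 𝒱.coord
  expand _ hI X := 𝒱.sum_coord_smul hI X
  dual _ hI _ hi _ hj := 𝒱.coord_vec hI hi hj
  integral I hI i hi I' hI' j hj := by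
    obtain ⟨m, hm⟩ := 𝒱.exists_int_of_mem_lattice (𝒱.vec_mem_lattice h𝒱 hI hI' hj)
    exact ⟨m i, by rw [hm, 𝒱.coord_sum_smul_vec hI hi]⟩
  chern I hI I' hI' j hj := by
    obtain ⟨m, hm⟩ := 𝒱.exists_int_of_mem_lattice (𝒱.vec_mem_lattice h𝒱 hI hI' hj)
    obtain ⟨u, y, hu⟩ := 𝒱.exists_dual_of_firstChernDivisible hc
    -- Obtained by applying u to v_j = ∑ m_i v_i and solving 1 + N y_j = ∑ m_i (1 + N y_i) for ∑
    -- m_i.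
    refine ⟨y j - ∑ i ∈ I, m i * y i, ?_⟩
    rw [hm, Finset.sum_congr rfl fun i hi => 𝒱.coord_sum_smul_vec hI hi m]
    have h := hu j
    rw [hm, map_sum] at h
    simp only [map_zsmul, hu, smul_eq_mul, mul_add, mul_one, Finset.sum_add_distrib] at h
    have h2 : ∑ i ∈ I, m i = 1 + N * (y j - ∑ i ∈ I, m i * y i) := by
      rw [mul_sub, Finset.mul_sum, ← sub_eq_zero, ← sub_eq_zero.2 h]
      simp only [mul_left_comm]
      ring
    exact_mod_cast h2

/-! ### Cones and completeness -/

/-- The edge vectors span the cones. -/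
theorem cone_eq_hull {I : Finset V} (hI : I ∈ Δ.faces) :
    Δ.cone I = PointedCone.hull ℝ ((fun i => (1 : ℝ) ⊗ₜ[ℤ] 𝒱.vec i) '' (I : Set V)) := by
  obtain ⟨ρ, hρ⟩ := Δ.exists_generators
  have h : ∀ i, PointedCone.hull ℝ {(1 : ℝ) ⊗ₜ[ℤ] ρ i} =
      PointedCone.hull ℝ {(1 : ℝ) ⊗ₜ[ℤ] 𝒱.vec i} := fun i => by
    rw [← 𝒱.generates i, (hρ {i} (Δ.singleton_mem i)).2]
    simp
  rw [(hρ I hI).2]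
  apply le_antisymm
  · rw [Submodule.span_le]
    rintro _ ⟨i, hi, rfl⟩
    have h1 : (1 : ℝ) ⊗ₜ[ℤ] ρ i ∈ PointedCone.hull ℝ {(1 : ℝ) ⊗ₜ[ℤ] 𝒱.vec i} :=
      h i ▸ Submodule.subset_span rfl
    exact Submodule.span_mono (by rintro _ rfl; exact ⟨i, hi, rfl⟩) h1
  · rw [Submodule.span_le]
    rintro _ ⟨i, hi, rfl⟩
    have h1 : (1 : ℝ) ⊗ₜ[ℤ] 𝒱.vec i ∈ PointedCone.hull ℝ {(1 : ℝ) ⊗ₜ[ℤ] ρ i} :=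
      h i ▸ Submodule.subset_span rfl
    exact Submodule.span_mono (by rintro _ rfl; exact ⟨i, hi, rfl⟩) h1

/-- The real coordinate functions attached to a facet. -/
theorem exists_real_coord {I : Finset V} (hI : I ∈ Δ.top) {i : V} (hi : i ∈ I) :
    ∃ ℓ : (ℝ ⊗[ℤ] L) →ₗ[ℝ] ℝ, ∀ j ∈ I, ℓ ((1 : ℝ) ⊗ₜ[ℤ] 𝒱.vec j) = if i = j then 1 else 0 := by
  have hli : LinearIndependent ℝ (fun i : I => (1 : ℝ) ⊗ₜ[ℤ] 𝒱.vec i) :=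
    Module.Flat.linearIndependent_one_tmul (𝒱.linearIndependent (mem_top.1 hI).1)
  let b : Module.Basis I ℝ (ℝ ⊗[ℤ] L) :=
    Module.Basis.mk hli (hli.span_eq_top_of_card_eq_finrank' (by
      rw [Fintype.card_coe, (mem_top.1 hI).2, Module.finrank_baseChange])).ge
  refine ⟨b.coord ⟨i, hi⟩, fun j hj => ?_⟩
  have : (1 : ℝ) ⊗ₜ[ℤ] 𝒱.vec j = b ⟨j, hj⟩ := by simp [b]
  rw [this, Module.Basis.coord_apply, Module.Basis.repr_self, Finsupp.single_apply]
  simp [Subtype.ext_iff, eq_comm]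

theorem vec_mem_cone {I : Finset V} (hI : I ∈ Δ.faces) {i : V} (hi : i ∈ I) :
    (1 : ℝ) ⊗ₜ[ℤ] 𝒱.vec i ∈ Δ.cone I := by
  rw [𝒱.cone_eq_hull hI]
  exact Submodule.subset_span ⟨i, hi, rfl⟩

theorem nonneg_of_mem_cone {I : Finset V} (hI : I ∈ Δ.faces) (ℓ : (ℝ ⊗[ℤ] L) →ₗ[ℝ] ℝ)
    (hℓ : ∀ i ∈ I, 0 ≤ ℓ ((1 : ℝ) ⊗ₜ[ℤ] 𝒱.vec i)) {x : ℝ ⊗[ℤ] L} (hx : x ∈ Δ.cone I) :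
    0 ≤ ℓ x := by
  rw [𝒱.cone_eq_hull hI] at hx
  induction hx using Submodule.span_induction with
  | mem x hx =>
    obtain ⟨i, hi, rfl⟩ := hx
    exact hℓ i hi
  | zero => simp
  | add x y _ _ hx hy => rw [map_add]; exact add_nonneg hx hy
  | smul a x _ hx =>
    have : ℓ (a • x) = (a : ℝ) * ℓ x := by
      rw [← smul_eq_mul, ← map_smul]; rfl
    rw [this]
    exact mul_nonneg a.2 hx

/-- Both ℓ and -ℓ are nonnegative on the cone. -/
theorem eq_zero_of_mem_span_cone {J : Finset V} (hJ : J ∈ Δ.faces) (ℓ : (ℝ ⊗[ℤ] L) →ₗ[ℝ] ℝ)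
    (hℓ : ∀ i ∈ J, ℓ ((1 : ℝ) ⊗ₜ[ℤ] 𝒱.vec i) = 0) {x : ℝ ⊗[ℤ] L}
    (hx : x ∈ Submodule.span ℝ (Δ.cone J : Set (ℝ ⊗[ℤ] L))) : ℓ x = 0 := by
  rw [← LinearMap.mem_ker]
  refine (Submodule.span_le.2 fun y hy => ?_ : Submodule.span ℝ _ ≤ LinearMap.ker ℓ) hx
  rw [SetLike.mem_coe, LinearMap.mem_ker]
  have h1 := 𝒱.nonneg_of_mem_cone hJ ℓ (fun i hi => (hℓ i hi).ge) hy
  have h2 := 𝒱.nonneg_of_mem_cone hJ (-ℓ) (fun i hi => by simp [hℓ i hi]) hy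
  rw [LinearMap.neg_apply] at h2
  linarith

/-- The image of an edge vector in the projection along a cone. -/
def projVec (J : Finset V) (i : V) : Δ.ProjSpace J :=
  Submodule.mkQ (Submodule.span ℝ (Δ.cone J : Set (ℝ ⊗[ℤ] L))) ((1 : ℝ) ⊗ₜ[ℤ] 𝒱.vec i)

theorem projVec_mem {I : Finset V} (hI : I ∈ Δ.top) {i : V} (hi : i ∈ I) :
    𝒱.projVec (I.erase i) i ∈ Δ.projCone (I.erase i) I :=
  PointedCone.mem_map.2 ⟨_, 𝒱.vec_mem_cone (mem_top.1 hI).1 hi, rfl⟩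

theorem erase_mem_faces {I : Finset V} (hI : I ∈ Δ.top) (i : V) : I.erase i ∈ Δ.faces :=
  Δ.down_closed I (mem_top.1 hI).1 _ (Finset.erase_subset _ _)

/-- The coordinate dual to v_i vanishes on the ridge, is nonnegative on C(I), and would equal -1 on
a lift of -v_i. Thus each facet occupies only one side of its ridge. -/
theorem neg_projVec_notMem {I : Finset V} (hI : I ∈ Δ.top) {i : V} (hi : i ∈ I) :
    -𝒱.projVec (I.erase i) i ∉ Δ.projCone (I.erase i) I := by
  intro h
  obtain ⟨x, hx, hxi⟩ := PointedCone.mem_map.1 h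
  obtain ⟨ℓ, hℓ⟩ := 𝒱.exists_real_coord hI hi
  have h1 : x + (1 : ℝ) ⊗ₜ[ℤ] 𝒱.vec i ∈
      Submodule.span ℝ (Δ.cone (I.erase i) : Set (ℝ ⊗[ℤ] L)) := by
    rw [← Submodule.Quotient.mk_eq_zero, ← Submodule.mkQ_apply, map_add, hxi]
    exact neg_add_cancel _
  have h2 := 𝒱.eq_zero_of_mem_span_cone (erase_mem_faces hI i) ℓ (fun j hj => by
    rw [hℓ j (Finset.mem_of_mem_erase hj), if_neg (Finset.ne_of_mem_erase hj).symm]) h1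
  have h3 := 𝒱.nonneg_of_mem_cone (mem_top.1 hI).1 ℓ (fun j hj => by
    rw [hℓ j hj]; split_ifs <;> norm_num) hx
  rw [map_add, hℓ i hi, if_pos rfl] at h2
  linarith

theorem projVec_ne_zero {I : Finset V} (hI : I ∈ Δ.top) {i : V} (hi : i ∈ I) :
    𝒱.projVec (I.erase i) i ≠ 0 := by
  intro h
  apply 𝒱.neg_projVec_notMem hI hi
  rw [h, neg_zero]
  exact Submodule.zero_mem _

/-- In the one-dimensional fan obtained by projecting along a ridge, all nonzero vectors are
generic. -/
theorem isProjGeneric_ridge {I : Finset V} (hI : I ∈ Δ.top) {i : V} (hi : i ∈ I)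
    {x : Δ.ProjSpace (I.erase i)} (hx : x ≠ 0) : Δ.IsProjGeneric (I.erase i) x := by
  intro J hJ hsub hcard hmem
  have hJeq : I.erase i = J := by
    refine Finset.eq_of_subset_of_card_le hsub ?_
    rw [Finset.card_erase_of_mem hi, (mem_top.1 hI).2]
    omega
  rw [← hJeq] at hmem
  apply hx
  have : Submodule.span ℝ (Δ.projCone (I.erase i) (I.erase i) : Set (Δ.ProjSpace (I.erase i))) ≤ ⊥ := by
    rw [Submodule.span_le]
    intro y hy
    obtain ⟨z, hz, rfl⟩ := PointedCone.mem_map.1 hy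
    exact (Submodule.Quotient.mk_eq_zero _).2 (Submodule.subset_span hz)
  simpa using this hmem

-- A facet containing the ridge has exactly one further vertex, so such facets correspond to the
-- pairs (I, i) indexing the balancing condition.
open Classical in
theorem projDegree_ridge {I₀ : Finset V} (hI₀ : I₀ ∈ Δ.top) {i₀ : V} (hi₀ : i₀ ∈ I₀)
    (x : Δ.ProjSpace (I₀.erase i₀)) :
    Δ.projDegree (I₀.erase i₀) x =
      ∑ p ∈ (Δ.top.sigma fun I => I) with p.1.erase p.2 = I₀.erase i₀,
        if x ∈ Δ.projCone (I₀.erase i₀) p.1 then Δ.w p.1 else 0 := by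
  rw [projDegree, ← Finset.sum_filter]
  symm
  refine Finset.sum_bij (fun p _ => p.1) ?_ ?_ ?_ ?_
  · rintro ⟨I, i⟩ hp
    simp only [Finset.mem_filter, Finset.mem_sigma] at hp ⊢
    obtain ⟨⟨⟨hI, hi⟩, he⟩, hx⟩ := hp
    exact ⟨hI, he ▸ Finset.erase_subset _ _, hx⟩
  · rintro ⟨I, i⟩ hp ⟨I', i'⟩ hp' h
    simp only [Finset.mem_filter, Finset.mem_sigma] at hp hp' h
    subst h
    obtain ⟨⟨⟨hI, hi⟩, he⟩, hx⟩ := hp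
    obtain ⟨⟨⟨-, hi'⟩, he'⟩, -⟩ := hp'
    have : i = i' := by
      by_contra hne
      have h1 : i ∈ I.erase i' := Finset.mem_erase.2 ⟨hne, hi⟩
      rw [he', ← he] at h1
      simp at h1
    rw [this]
  · intro I hI
    simp only [Finset.mem_filter] at hI
    obtain ⟨hI, hsub, hx⟩ := hI
    have hc : (I₀.erase i₀).card + 1 = I.card := by
      rw [Finset.card_erase_add_one hi₀, (mem_top.1 hI).2, (mem_top.1 hI₀).2]
    obtain ⟨i, hi⟩ : ∃ i, I \ (I₀.erase i₀) = {i} := by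
      rw [← Finset.card_eq_one, Finset.card_sdiff_of_subset hsub]
      omega
    have hiI : i ∈ I ∧ i ∉ I₀.erase i₀ := by
      rw [← Finset.mem_sdiff, hi]; simp
    have he : I.erase i = I₀.erase i₀ := by
      rw [Finset.erase_eq, ← hi, Finset.sdiff_sdiff_eq_self hsub]
    refine ⟨⟨I, i⟩, ?_, rfl⟩
    simp only [Finset.mem_filter, Finset.mem_sigma]
    exact ⟨⟨⟨hI, hiI.1⟩, he⟩, hx⟩
  · intro p _
    rfl

/-- Crossing a ridge: the image of `v_{i₀}` in the projection along the ridge is `±` that of `vᵢ`. -/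
theorem projVec_eq_smul {I I₀ : Finset V} (hI : I ∈ Δ.top) {i i₀ : V} (hi : i ∈ I)
    (he : I.erase i = I₀.erase i₀) (hmem : 𝒱.vec i₀ ∈ 𝒱.lattice I) {ε : ℤ}
    (hε : 𝒱.coord I i ((1 : ℂ) ⊗ₜ[ℤ] 𝒱.vec i₀) = ε) :
    𝒱.projVec (I₀.erase i₀) i₀ = ε • 𝒱.projVec (I₀.erase i₀) i := by
  obtain ⟨m, hm⟩ := 𝒱.exists_int_of_mem_lattice hmem
  rw [hm, 𝒱.coord_sum_smul_vec hI hi] at hε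
  have hε' : m i = ε := by exact_mod_cast hε
  have hz : ∀ j ∈ I.erase i, 𝒱.projVec (I₀.erase i₀) j = 0 := fun j hj => by
    have hf := erase_mem_faces hI i
    rw [he] at hj hf
    exact (Submodule.Quotient.mk_eq_zero _).2
      (Submodule.subset_span (𝒱.vec_mem_cone hf hj))
  have h1 : 𝒱.projVec (I₀.erase i₀) i₀ = ∑ j ∈ I, m j • 𝒱.projVec (I₀.erase i₀) j := by
    conv_lhs => rw [projVec, hm, TensorProduct.tmul_sum, map_sum]
    refine Finset.sum_congr rfl fun j _ => ?_
    rw [TensorProduct.tmul_smul, map_zsmul]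
    rfl
  rw [h1, ← Finset.add_sum_erase _ _ hi, hε',
    Finset.sum_eq_zero fun j hj => by rw [hz j hj, smul_zero], add_zero]

/-- The facet system of a complete multi-fan. -/
def facetSystem (hΔ : Δ.IsComplete) (h𝒱 : 𝒱.IsGlobalType) {N : ℕ}
    (hc : 𝒱.FirstChernDivisible N) : FacetSystem V (ℂ ⊗[ℤ] L) N where
  toFacetBases := 𝒱.facetBases h𝒱 hc
  w := Δ.w
  balance I₀ hI₀ i₀ hi₀ := by
    classical
    change I₀ ∈ Δ.top at hI₀
    have hne := 𝒱.projVec_ne_zero hI₀ hi₀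
    -- The degrees on the two sides of the ridge agree; in their difference a facet contributes w(I)
    -- times the sign of its side.
    have hdeg := hΔ (I₀.erase i₀) (erase_mem_faces hI₀ i₀) (𝒱.projVec (I₀.erase i₀) i₀)
      (-𝒱.projVec (I₀.erase i₀) i₀) (isProjGeneric_ridge hI₀ hi₀ hne)
      (isProjGeneric_ridge hI₀ hi₀ (neg_ne_zero.2 hne))
    rw [projDegree_ridge hI₀ hi₀, projDegree_ridge hI₀ hi₀, ← sub_eq_zero,
      ← Finset.sum_sub_distrib] at hdeg
    have hcast := congrArg (fun n : ℤ => (n : ℂ)) hdeg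
    simp only [Int.cast_sum, Int.cast_zero] at hcast
    rw [← hcast]
    refine Finset.sum_congr rfl ?_
    rintro ⟨I, i⟩ hp
    obtain ⟨hp, he⟩ := Finset.mem_filter.1 hp
    obtain ⟨hI, hi⟩ := Finset.mem_sigma.1 hp
    dsimp only at hI hi he ⊢
    change I ∈ Δ.top at hI
    obtain ⟨-, -, hpm⟩ := (𝒱.facetBases h𝒱 hc).exists_basis_change hI₀ hI hi₀ hi he
    have hmem := 𝒱.vec_mem_lattice h𝒱 hI hI₀ hi₀
    have hin := 𝒱.projVec_mem hI hi
    have hout := 𝒱.neg_projVec_notMem hI hi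
    rw [he] at hin hout
    change 𝒱.coord I i ((1 : ℂ) ⊗ₜ[ℤ] 𝒱.vec i₀) = 1 ∨
      𝒱.coord I i ((1 : ℂ) ⊗ₜ[ℤ] 𝒱.vec i₀) = -1 at hpm
    change (Δ.w I : ℂ) * 𝒱.coord I i ((1 : ℂ) ⊗ₜ[ℤ] 𝒱.vec i₀) = _
    rcases hpm with h | h
    · have := 𝒱.projVec_eq_smul hI hi he hmem (ε := 1) (by simpa using h)
      rw [one_smul] at this
      rw [this, if_pos hin, if_neg hout, h]
      simp
    · have := 𝒱.projVec_eq_smul hI hi he hmem (ε := -1) (by simpa using h)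
      rw [neg_one_smul] at this
      rw [this, neg_neg, if_pos hin, if_neg hout, h]
      simp

end EdgeVectors

end SimplicialMultiFan

/-! ## Uniqueness of expansions -/

section Uniqueness

open Filter Topology

/-- Let q → 0⁺ under the sum, dominated by the series at q = 1/2. -/
theorem coeff_zero_eq_zero_of_hasSum {c : ℕ → ℂ}
    (h : ∀ q : ℝ, 0 < q → q < 1 → HasSum (fun s => c s * (q : ℂ) ^ s) 0) : c 0 = 0 := by
  have h0 := (h (1 / 2) (by norm_num) (by norm_num)).summable.norm
  have hlim : ∀ s, Tendsto (fun q : ℝ => c s * (q : ℂ) ^ s) (𝓝[>] 0) (𝓝 (c s * (0 : ℂ) ^ s)) := by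
    intro s
    have : Continuous fun q : ℝ => c s * (q : ℂ) ^ s := by fun_prop
    simpa using (this.tendsto 0).mono_left nhdsWithin_le_nhds
  have hsmall : ∀ᶠ q : ℝ in 𝓝[>] 0, 0 < q ∧ q < 1 / 2 :=
    Ioo_mem_nhdsGT (by norm_num)
  have h1 := tendsto_tsum_of_dominated_convergence h0 hlim (by
    filter_upwards [hsmall] with q hq s
    simp only [norm_mul, norm_pow, Complex.norm_real, Real.norm_eq_abs, abs_of_pos hq.1]
    norm_num
    have := hq.1
    gcongr
    exact le_trans hq.2.le (by norm_num))
  have h2 : Tendsto (fun q : ℝ => ∑' s, c s * (q : ℂ) ^ s) (𝓝[>] 0) (𝓝 0) := by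
    refine (tendsto_congr' ?_).2 tendsto_const_nhds
    filter_upwards [hsmall] with q hq
    exact (h q hq.1 (by linarith [hq.2])).tsum_eq
  have h3 := tendsto_nhds_unique h1 h2
  rw [tsum_eq_single 0 (by intro s hs; simp [hs])] at h3
  simpa using h3

theorem coeff_eq_zero_of_hasSum {c : ℕ → ℂ}
    (h : ∀ q : ℝ, 0 < q → q < 1 → HasSum (fun s => c s * (q : ℂ) ^ s) 0) (n : ℕ) : c n = 0 := by
  induction n generalizing c with
  | zero => exact coeff_zero_eq_zero_of_hasSum h
  | succ n ih =>
    refine ih (c := fun s => c (s + 1)) fun q hq hq1 => ?_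
    have h0 := coeff_zero_eq_zero_of_hasSum h
    have h1 := (hasSum_nat_add_iff' 1).2 (h q hq hq1)
    simp only [Finset.range_one, Finset.sum_singleton, h0, zero_mul, sub_zero] at h1
    have h2 := h1.mul_right (q : ℂ)⁻¹
    have hq0 : (q : ℂ) ≠ 0 := by exact_mod_cast hq.ne'
    rw [zero_mul] at h2
    have e : (fun s => c (s + 1) * (q : ℂ) ^ s) =
        fun s => c (s + 1) * (q : ℂ) ^ (s + 1) * (q : ℂ)⁻¹ := by
      funext s
      rw [pow_succ]
      field_simp
    rw [e]
    exact h2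

/-- A power series in the nome that vanishes on the upper half plane is zero. -/
theorem coeff_eq_zero_of_hasSum_nome {c : ℕ → ℂ}
    (h : ∀ τ : UpperHalfPlane, HasSum (fun s => c s * nome τ ^ s) 0) (n : ℕ) : c n = 0 := by
  refine coeff_eq_zero_of_hasSum (fun q hq hq1 => ?_) n
  have hlog := Real.log_neg hq hq1
  have hpi := Real.pi_pos
  let τ : UpperHalfPlane := ⟨Complex.I * ((-Real.log q / (2 * Real.pi) : ℝ) : ℂ), by
    simp only [Complex.mul_im, Complex.I_re, Complex.I_im, Complex.ofReal_re, Complex.ofReal_im]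
    have : 0 < -Real.log q / (2 * Real.pi) := by apply div_pos <;> linarith
    linarith⟩
  have hτ : nome τ = q := by
    have e : (2 * Real.pi * Complex.I * (τ : ℂ) : ℂ) = ((Real.log q : ℝ) : ℂ) := by
      change 2 * Real.pi * Complex.I *
        (Complex.I * ((-Real.log q / (2 * Real.pi) : ℝ) : ℂ)) = _
      push_cast
      have : (Real.pi : ℂ) ≠ 0 := by exact_mod_cast hpi.ne'
      field_simp
      rw [Complex.I_sq]
      ring
    rw [nome, e, ← Complex.ofReal_exp, Real.exp_log hq]
  have := h τ
  rwa [hτ] at this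

/-- The character `t ↦ e^{2πikt}` of the additive group of real numbers. -/
def realCharacter (k : ℤ) : Multiplicative ℝ →* ℂ where
  toFun z := Complex.exp (2 * Real.pi * Complex.I * (k : ℂ) * ((z.toAdd : ℝ) : ℂ))
  map_one' := by simp
  map_mul' x y := by
    rw [← Complex.exp_add]
    simp
    ring_nf

/-- Evaluate at √2: equality would make (k - l)√2 an integer. -/
theorem realCharacter_injective : Function.Injective realCharacter := by
  intro k l hkl
  have h := DFunLike.congr_fun hkl (Multiplicative.ofAdd (√2))
  simp only [realCharacter, MonoidHom.coe_mk, OneHom.coe_mk, toAdd_ofAdd] at h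
  have h1 : Complex.exp (2 * Real.pi * Complex.I * (((k - l : ℤ) : ℂ) * ((√2 : ℝ) : ℂ))) = 1 := by
    have e : (2 * Real.pi * Complex.I * (((k - l : ℤ) : ℂ) * ((√2 : ℝ) : ℂ)) : ℂ) =
      2 * Real.pi * Complex.I * (k : ℂ) * ((√2 : ℝ) : ℂ) -
        2 * Real.pi * Complex.I * (l : ℂ) * ((√2 : ℝ) : ℂ) := by push_cast; ring
    rw [e, Complex.exp_sub, h, div_self (Complex.exp_ne_zero _)]
  obtain ⟨m, hm⟩ := (exp_two_pi_eq_one_iff _).1 h1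
  have hm' : ((k - l : ℤ) : ℝ) * √2 = m := by exact_mod_cast hm
  by_contra hne
  have hk : k - l ≠ 0 := sub_ne_zero.2 hne
  exact (irrational_sqrt_two.intCast_mul hk).ne_int m hm'

/-- A trigonometric polynomial with distinct frequencies that vanishes at all irrational numbers is
zero. -/
theorem eq_zero_of_trigonometric_sum {ι : Type*} (s : Finset ι) (a : ι → ℂ) (k : ι → ℤ)
    (hk : Set.InjOn k s)
    (h : ∀ z : ℝ, Irrational z →
      ∑ u ∈ s, a u * Complex.exp (2 * Real.pi * Complex.I * (k u : ℂ) * (z : ℂ)) = 0) :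
    ∀ u ∈ s, a u = 0 := by
  have hall : (fun z : ℝ =>
      ∑ u ∈ s, a u * Complex.exp (2 * Real.pi * Complex.I * (k u : ℂ) * (z : ℂ))) = fun _ => 0 := by
    refine Continuous.ext_on dense_irrational (by fun_prop) continuous_const fun z hz => h z hz
  -- Continuity has extended the vanishing to all real z, so Dedekind's independence of characters
  -- applies on the whole group ℝ.
  have hli := (linearIndependent_monoidHom (Multiplicative ℝ) ℂ).comp
    (fun u : s => realCharacter (k u)) fun u v huv =>
      Subtype.ext (hk u.2 v.2 (realCharacter_injective huv))
  have h2 := Fintype.linearIndependent_iff.1 hli (fun u => a u) (by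
    funext z
    have := congrFun hall z.toAdd
    rw [← Finset.sum_coe_sort] at this
    simpa [realCharacter] using this)
  exact fun u hu => h2 ⟨u, hu⟩

end Uniqueness

/-- Transports sums from H_I to L/L_𝒱: equal lattices still give distinct quotient types, possibly
with different `Fintype` instances. -/
theorem sum_quotient_out_eq {L : Type*} [AddCommGroup L] {M M' : Submodule ℤ L} (h : M = M') [i₁ : Fintype (L ⧸ M)]
    [i₂ : Fintype (L ⧸ M')] (f : L → ℂ) :
    ∑ x : L ⧸ M, f (Quotient.out x) = ∑ x : L ⧸ M', f (Quotient.out x) := by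
  subst h
  obtain rfl : i₁ = i₂ := Subsingleton.elim _ _
  rfl

/-! ### Vanishing of the elliptic genus as a function and as a power series -/

namespace SimplicialMultiFan

variable {L : Type*} [AddCommGroup L] [Module.Free ℤ L] [Module.Finite ℤ L]
  {V : Type*} [Fintype V] [DecidableEq V] {Δ : SimplicialMultiFan L V}

/-- A nonzero additive function on `L` vanishing on the span of a cone that is not of maximal
dimension. -/
theorem exists_addMonoidHom_of_card_lt (𝒱 : Δ.EdgeVectors) {J : Finset V} (hJ : J ∈ Δ.faces)
    (hcard : J.card < Module.finrank ℤ L) :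
    ∃ f : L →+ ℂ, (∃ x, f x ≠ 0) ∧ ∀ x : L, (1 : ℝ) ⊗ₜ[ℤ] x ∈
      Submodule.span ℝ (Δ.cone J : Set (ℝ ⊗[ℤ] L)) → f x = 0 := by
  classical
  set T : Finset (ℝ ⊗[ℤ] L) := J.image fun i => (1 : ℝ) ⊗ₜ[ℤ] 𝒱.vec i with hT
  have hlt : Submodule.span ℝ (T : Set (ℝ ⊗[ℤ] L)) < ⊤ := by
    rw [lt_top_iff_ne_top]
    intro htop
    have h1 := finrank_span_finset_le_card (R := ℝ) T
    have h2 : (T : Set (ℝ ⊗[ℤ] L)).finrank ℝ = Module.finrank ℤ L := by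
      rw [Set.finrank, htop, finrank_top, Module.finrank_baseChange]
    have h3 : T.card ≤ J.card := Finset.card_image_le
    omega
  obtain ⟨g, hg0, hg⟩ := Submodule.exists_le_ker_of_lt_top _ hlt
  refine ⟨AddMonoidHom.mk' (fun x => ((g ((1 : ℝ) ⊗ₜ[ℤ] x) : ℝ) : ℂ)) fun x y => by
    simp [TensorProduct.tmul_add], ?_, fun x hx => ?_⟩
  · by_contra! hx
    apply hg0
    refine TensorProduct.AlgebraTensorModule.curry_injective ?_
    ext x
    simpa using hx x
  · have h0 := 𝒱.eq_zero_of_mem_span_cone hJ g (fun i hi => by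
      rw [← LinearMap.mem_ker]
      refine hg (Submodule.subset_span ?_)
      rw [hT, Finset.mem_coe]
      exact Finset.mem_image_of_mem _ hi) hx
    simpa using h0

namespace EdgeVectors

variable (𝒱 : Δ.EdgeVectors)

theorem exists_mem_top (hL : 0 < Module.finrank ℤ L) : ∃ I ∈ Δ.top, I.Nonempty := by
  obtain ⟨I, hI, hc⟩ := Δ.exists_top
  exact ⟨I, mem_top.2 ⟨hI, hc⟩, Finset.card_pos.1 (hc ▸ hL)⟩

/-- Under (P) the sum over h can be pulled outside the sum over I, leaving an average of values of
`genus` at W + v(h). `IsRegular` covers all translates by L, so each value vanishes. -/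
theorem ellipticGenusFun_eq_zero (hL : 0 < Module.finrank ℤ L) (hΔ : Δ.IsComplete) {N : ℕ}
    (hN : N ≠ 0) {σ : ℂ} (hσN : Complex.exp (2 * Real.pi * Complex.I * σ) ^ N = 1)
    (hσ : Complex.exp (2 * Real.pi * Complex.I * σ) ≠ 1) (h𝒱 : 𝒱.IsGlobalType)
    (hc : 𝒱.FirstChernDivisible N) (W : ℂ ⊗[ℤ] L) (τ : UpperHalfPlane) (hW : 𝒱.IsRegular W τ) :
    𝒱.ellipticGenusFun W τ σ = 0 := by
  obtain ⟨I₀, hI₀, hne⟩ := exists_mem_top (Δ := Δ) hL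
  have hfin : Finite (L ⧸ 𝒱.commonLattice) := by
    rw [← h𝒱 I₀ hI₀]
    exact 𝒱.finite_quotient ⟨I₀, hI₀⟩
  let : Fintype (L ⧸ 𝒱.commonLattice) := Fintype.ofFinite _
  have hneg : ∀ x : L, -W - (1 : ℂ) ⊗ₜ[ℤ] x = -(W + (1 : ℂ) ⊗ₜ[ℤ] x) := fun x => by abel
  have hgenus : ∀ x : L, (𝒱.facetSystem hΔ h𝒱 hc).genus τ σ (W + (1 : ℂ) ⊗ₜ[ℤ] x) = 0 := by
    intro x
    refine FacetSystem.genus_eq_zero hN hσN hσ ⟨I₀, hI₀, hne⟩ fun I hI i hi => ?_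
    have h1 := hW ⟨I, hI⟩ ⟨i, hi⟩ x
    rw [← coord_coe, hneg, map_neg] at h1
    exact h1
  have hterm : ∀ I : Δ.top, ((Δ.w I.1 : ℂ) / (Nat.card (L ⧸ 𝒱.lattice I.1) : ℂ)) *
      ∑ h : L ⧸ 𝒱.lattice I.1, ∏ i : I.1,
        ellipticPhi (𝒱.dualVec I i (-W - (1 : ℂ) ⊗ₜ[ℤ] Quotient.out h)) τ σ =
      (Nat.card (L ⧸ 𝒱.commonLattice) : ℂ)⁻¹ * ∑ h : L ⧸ 𝒱.commonLattice, (Δ.w I.1 : ℂ) *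
        ∏ i ∈ I.1, ellipticPhi (-(𝒱.coord I.1 i (W + (1 : ℂ) ⊗ₜ[ℤ] Quotient.out h))) τ σ := by
    intro I
    rw [sum_quotient_out_eq (h𝒱 I.1 I.2) fun x => ∏ i : I.1,
      ellipticPhi (𝒱.dualVec I i (-W - (1 : ℂ) ⊗ₜ[ℤ] x)) τ σ, h𝒱 I.1 I.2, div_eq_inv_mul,
      mul_assoc, Finset.mul_sum]
    congr 1
    refine Finset.sum_congr rfl fun h _ => ?_
    congr 1
    rw [← Finset.prod_coe_sort I.1]
    refine Finset.prod_congr rfl fun i _ => ?_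
    rw [← coord_coe, hneg, map_neg]
  rw [ellipticGenusFun, Finset.sum_congr rfl fun I _ => hterm I, ← Finset.mul_sum,
    Finset.sum_comm, Finset.sum_eq_zero, mul_zero]
  intro h _
  rw [Finset.sum_coe_sort Δ.top fun I => (Δ.w I : ℂ) *
        ∏ i ∈ I, ellipticPhi (-(𝒱.coord I i (W + (1 : ℂ) ⊗ₜ[ℤ] Quotient.out h))) τ σ]
  exact hgenus _

/-- A positive multiple of any lattice vector lies in the lattice of each facet. -/
theorem exists_pos_smul_mem_lattice {I : Finset V} (hI : I ∈ Δ.top) :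
    ∃ n : ℕ, 0 < n ∧ ∀ x : L, n • x ∈ 𝒱.lattice I := by
  have := 𝒱.finite_quotient ⟨I, hI⟩
  refine ⟨Nat.card (L ⧸ 𝒱.lattice I), Nat.card_pos, fun x => ?_⟩
  rw [← Submodule.Quotient.mk_eq_zero, Submodule.Quotient.mk_smul]
  exact card_nsmul_eq_zero'

/-- At an irrational multiple of a vector of the lattice pairing nontrivially with the dual vectors,
the elliptic genus is regular. -/
theorem isRegular_of_irrational {v : L} (hv : v ∈ 𝒱.commonLattice)
    (hv0 : ∀ I ∈ Δ.top, ∀ i ∈ I, 𝒱.coord I i ((1 : ℂ) ⊗ₜ[ℤ] v) ≠ 0) {z : ℝ} (hz : Irrational z)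
    (τ : UpperHalfPlane) : 𝒱.IsRegular ((z : ℂ) ⊗ₜ[ℤ] v) τ := by
  rintro ⟨I, hI⟩ ⟨i, hi⟩ x
  rw [← coord_coe]
  dsimp only
  have hvI : v ∈ 𝒱.lattice I := by
    simp only [commonLattice, Submodule.mem_iInf] at hv
    exact hv I hI
  obtain ⟨a, ha⟩ : ∃ a : ℤ, 𝒱.coord I i ((1 : ℂ) ⊗ₜ[ℤ] v) = a := by
    obtain ⟨m, hm⟩ := 𝒱.exists_int_of_mem_lattice hvI
    exact ⟨m i, by rw [hm, 𝒱.coord_sum_smul_vec hI hi]⟩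
  have ha0 : a ≠ 0 := by
    have := hv0 I hI i hi
    rw [ha] at this
    exact_mod_cast this
  obtain ⟨n, hn, hnx⟩ := 𝒱.exists_pos_smul_mem_lattice hI
  obtain ⟨b, hb⟩ : ∃ b : ℤ, n * 𝒱.coord I i ((1 : ℂ) ⊗ₜ[ℤ] x) = b := by
    obtain ⟨m, hm⟩ := 𝒱.exists_int_of_mem_lattice (hnx x)
    refine ⟨m i, ?_⟩
    rw [← 𝒱.coord_sum_smul_vec hI hi m, ← hm, TensorProduct.tmul_smul, map_nsmul, nsmul_eq_mul]
  have hzv : (z : ℂ) ⊗ₜ[ℤ] v = (z : ℂ) • ((1 : ℂ) ⊗ₜ[ℤ] v) := by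
    rw [TensorProduct.smul_tmul', smul_eq_mul, mul_one]
  have harg : -((z : ℂ) ⊗ₜ[ℤ] v) - (1 : ℂ) ⊗ₜ[ℤ] x =
      -((z : ℂ) • ((1 : ℂ) ⊗ₜ[ℤ] v) + (1 : ℂ) ⊗ₜ[ℤ] x) := by
    rw [hzv]; abel
  rw [harg, map_neg, map_add, map_smul, ha, smul_eq_mul]
  refine thetaPhi_neg_ne_zero ?_
  rintro ⟨m, k, hmk⟩
  -- Multiplying by n clears the denominators of the coordinates of x; the imaginary part then
  -- forces k = 0, and the real part would make z rational.
  have h1 : (n : ℂ) * (z * a) + b = n * (m + k * τ) := by rw [← hmk, ← hb]; ring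
  have him := congrArg Complex.im h1
  have hre := congrArg Complex.re h1
  simp at him hre
  have hk : k = 0 := by
    rcases him with h | h | h
    · omega
    · exact h
    · exact absurd h τ.im_ne_zero
  rw [hk] at hre
  have h2 : ((n * a : ℤ) : ℝ) * z = ((n * m - b : ℤ) : ℝ) := by
    push_cast
    simp at hre
    linarith
  exact (hz.intCast_mul (mul_ne_zero (by exact_mod_cast hn.ne') ha0)).ne_int _ h2

/-- A generic vector of `L_𝒱` that separates a given finite set of characters. -/
theorem exists_generic_separating (h𝒱 : 𝒱.IsGlobalType) (hL : 0 < Module.finrank ℤ L)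
    (s : Finset (Module.Dual ℤ L)) :
    ∃ v ∈ 𝒱.commonLattice, Δ.IsGeneric ((1 : ℝ) ⊗ₜ[ℤ] v) ∧
      (∀ I ∈ Δ.top, ∀ i ∈ I, 𝒱.coord I i ((1 : ℂ) ⊗ₜ[ℤ] v) ≠ 0) ∧
      Set.InjOn (fun u : Module.Dual ℤ L => u v) s := by
  classical
  obtain ⟨I₀, hI₀, -⟩ := exists_mem_top (Δ := Δ) hL
  obtain ⟨n, hn, hnx⟩ := 𝒱.exists_pos_smul_mem_lattice hI₀
  have hcone : ∀ J, J ∈ Δ.faces ∧ J.card < Module.finrank ℤ L → ∃ f : L →+ ℂ, (∃ x, f x ≠ 0) ∧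
      ∀ x : L, (1 : ℝ) ⊗ₜ[ℤ] x ∈ Submodule.span ℝ (Δ.cone J : Set (ℝ ⊗[ℤ] L)) → f x = 0 :=
    fun J hJ => exists_addMonoidHom_of_card_lt 𝒱 hJ.1 hJ.2
  choose! f hf0 hf using hcone
  -- The families `A`, `B` and `C` encode genericity, nonvanishing dual coordinates, and separation
  -- of the characters in s.
  let A : Finset (L →+ ℂ) := (Δ.faces.filter fun J => J.card < Module.finrank ℤ L).image f
  let c : (Σ _ : Finset V, V) → L →+ ℂ := fun p =>
    AddMonoidHom.mk' (fun x => 𝒱.coord p.1 p.2 ((1 : ℂ) ⊗ₜ[ℤ] x)) fun x y => by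
      simp [TensorProduct.tmul_add]
  let B : Finset (L →+ ℂ) := (Δ.top.sigma fun I => I).image c
  let d : Module.Dual ℤ L × Module.Dual ℤ L → L →+ ℂ := fun p =>
    (Int.castAddHom ℂ).comp (p.1 - p.2).toAddMonoidHom
  let C : Finset (L →+ ℂ) := ((s ×ˢ s).filter fun p => p.1 ≠ p.2).image d
  obtain ⟨x, hx⟩ := exists_forall_apply_ne_zero (A ∪ B ∪ C) (fun g => g) (by
    intro g hg
    rcases Finset.mem_union.1 hg with hg | hg
    · rcases Finset.mem_union.1 hg with hg | hg
      · obtain ⟨J, hJ, rfl⟩ := Finset.mem_image.1 hg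
        exact hf0 J (Finset.mem_filter.1 hJ)
      · obtain ⟨⟨I, i⟩, hp, rfl⟩ := Finset.mem_image.1 hg
        obtain ⟨hI, hi⟩ := Finset.mem_sigma.1 hp
        refine ⟨𝒱.vec i, ?_⟩
        simp [c, 𝒱.coord_vec hI hi hi]
    · obtain ⟨⟨u, u'⟩, hp, rfl⟩ := Finset.mem_image.1 hg
      have hne := (Finset.mem_filter.1 hp).2
      by_contra! h
      refine hne (LinearMap.ext fun y => ?_)
      have := h y
      simp only [d, AddMonoidHom.comp_apply, LinearMap.toAddMonoidHom_coe, LinearMap.sub_apply,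
        Int.coe_castAddHom, Int.cast_eq_zero] at this
      exact sub_eq_zero.1 this)
  -- Multiplication by n moves x into L_𝒱 without spoiling any of the nonvanishing conditions.
  have hx' : ∀ g ∈ A ∪ B ∪ C, g (n • x) ≠ 0 := fun g hg => by
    rw [map_nsmul, nsmul_eq_mul]
    exact mul_ne_zero (by exact_mod_cast hn.ne') (hx g hg)
  refine ⟨n • x, ?_, ?_, ?_, ?_⟩
  · rw [← h𝒱 I₀ hI₀]
    exact hnx x
  · intro J hJ hcard hmem
    refine hx' (f J) (Finset.mem_union_left _ (Finset.mem_union_left _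
      (Finset.mem_image_of_mem _ (Finset.mem_filter.2 ⟨hJ, hcard⟩)))) (hf J ⟨hJ, hcard⟩ _ hmem)
  · intro I hI i hi
    exact hx' (c ⟨I, i⟩) (Finset.mem_union_left _ (Finset.mem_union_right _
      (Finset.mem_image_of_mem _ (Finset.mem_sigma.2 ⟨hI, hi⟩))))
  · intro u hu u' hu' h
    by_contra hne
    refine hx' (d (u, u')) (Finset.mem_union_right _ (Finset.mem_image_of_mem _
      (Finset.mem_filter.2 ⟨Finset.mem_product.2 ⟨hu, hu'⟩, hne⟩))) ?_
    have h' : u (n • x) = u' (n • x) := h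
    simp only [d, AddMonoidHom.comp_apply, LinearMap.toAddMonoidHom_coe, LinearMap.sub_apply,
      Int.coe_castAddHom, h', sub_self, Int.cast_zero]

theorem pullbackEval_apply (v : L) (z : ℂ) (a : AddMonoidAlgebra ℂ (Module.Dual ℤ L)) :
    pullbackEval v z a = ∑ u ∈ a.coeff.support, a.coeff u *
      Complex.exp (2 * Real.pi * Complex.I * ((u v : ℤ) : ℂ) * z) := by
  rw [pullbackEval, AddMonoidAlgebra.lift_apply]
  rfl

/-- A power series representing the zero genus is zero. -/
theorem eq_zero_of_isEquivariantEllipticGenus (hL : 0 < Module.finrank ℤ L)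
    (h𝒱 : 𝒱.IsGlobalType) {σ : ℂ}
    (h0 : ∀ (W : ℂ ⊗[ℤ] L) (τ : UpperHalfPlane), 𝒱.IsRegular W τ → 𝒱.ellipticGenusFun W τ σ = 0)
    {Ψ : PowerSeries (AddMonoidAlgebra ℂ (Module.Dual ℤ L))}
    (hΨ : 𝒱.IsEquivariantEllipticGenus σ Ψ) : Ψ = 0 := by
  ext1 s
  set a := PowerSeries.coeff s Ψ with ha
  -- The vector depends on the coefficient studied. An irrational z is regular for every τ at once,
  -- so q-coefficients can be extracted with z fixed; then z varies.
  obtain ⟨v, hv, hgen, hv0, hinj⟩ := 𝒱.exists_generic_separating h𝒱 hL a.coeff.support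
  have hz : ∀ z : ℝ, Irrational z → pullbackEval v z a = 0 := by
    intro z hz
    refine coeff_eq_zero_of_hasSum_nome
      (c := fun s => pullbackEval v z (PowerSeries.coeff s Ψ)) (fun τ => ?_) s
    have hreg := 𝒱.isRegular_of_irrational hv hv0 hz τ
    have h1 := hΨ v hv hgen τ z hreg
    rw [ellipticGenusAlong, h0 _ τ hreg] at h1
    exact h1
  have h2 := eq_zero_of_trigonometric_sum a.coeff.support a.coeff (fun u => u v) hinj
    fun z hzi => by rw [← pullbackEval_apply]; exact hz z hzi
  have h3 : a.coeff = 0 := by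
    ext u
    by_cases hu : u ∈ a.coeff.support
    · exact h2 u hu
    · simpa using hu
  simpa using h3

theorem ellipticGenusVanishes (hL : 0 < Module.finrank ℤ L) (hΔ : Δ.IsComplete) {N : ℕ}
    (hN : N ≠ 0) {σ : ℂ} (hσN : Complex.exp (2 * Real.pi * Complex.I * σ) ^ N = 1)
    (hσ : Complex.exp (2 * Real.pi * Complex.I * σ) ≠ 1) (h𝒱 : 𝒱.IsGlobalType)
    (hc : 𝒱.FirstChernDivisible N) : 𝒱.EllipticGenusVanishes σ := by
  have h0 := 𝒱.ellipticGenusFun_eq_zero hL hΔ hN hσN hσ h𝒱 hc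
  refine ⟨h0, fun v _ _ z τ hreg => h0 _ τ hreg, fun Ψ =>
    ⟨𝒱.eq_zero_of_isEquivariantEllipticGenus hL h𝒱 h0, ?_⟩⟩
  rintro rfl v - - τ z hreg
  rw [ellipticGenusAlong, h0 _ τ hreg]
  simp [hasSum_zero]

/-- In a non-singular multi-fan, primitive edge vectors of a facet generate the lattice. -/
theorem IsPrimitive.lattice_eq_top (h𝒱 : 𝒱.IsPrimitive) (hns : Δ.IsNonsingular) {I : Finset V}
    (hI : I ∈ Δ.top) : 𝒱.lattice I = ⊤ := by
  obtain ⟨𝒲, -, hb⟩ := hns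
  obtain ⟨b, hb⟩ := hb I hI
  rw [eq_top_iff, ← b.span_eq, Submodule.span_le]
  rintro _ ⟨i, rfl⟩
  have h1 : (1 : ℝ) ⊗ₜ[ℤ] 𝒱.vec i ∈ PointedCone.hull ℝ {(1 : ℝ) ⊗ₜ[ℤ] 𝒲.vec i} := by
    rw [← 𝒲.generates, 𝒱.generates]
    exact Submodule.subset_span rfl
  obtain ⟨a, ha⟩ := Submodule.mem_span_singleton.1 h1
  rw [← hb i] at ha
  -- Both vectors span the same ray, so the other coordinates vanish after base change to ℝ; the
  -- remaining one is an integer, which primitivity makes ±1.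
  have h2 : 𝒱.vec i = b.repr (𝒱.vec i) i • b i := by
    refine b.repr.injective ?_
    ext j
    rw [map_smul, b.repr_self, Finsupp.smul_apply, Finsupp.single_apply, smul_eq_mul]
    split_ifs with hij
    · subst hij; simp
    · have h4 : (a : ℝ) • ((1 : ℝ) ⊗ₜ[ℤ] b i) = (1 : ℝ) ⊗ₜ[ℤ] 𝒱.vec i := ha
      have h5 := congrArg (fun y => (b.baseChange ℝ).repr y j) h4
      simp only [map_smul, Finsupp.smul_apply, Module.Basis.baseChange_repr_tmul, b.repr_self,
        Finsupp.single_apply, if_neg hij] at h5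
      simp at h5
      simpa using h5.symm
  have hu := h𝒱 i _ _ h2
  have hmem : 𝒱.vec i ∈ 𝒱.lattice I := Submodule.subset_span ⟨i, i.2, rfl⟩
  rcases Int.isUnit_iff.1 hu with h | h
  · rw [h, one_smul] at h2
    rw [SetLike.mem_coe, ← h2]
    exact hmem
  · rw [h, neg_one_smul] at h2
    rw [SetLike.mem_coe, ← neg_neg (b i), ← h2]
    exact Submodule.neg_mem _ hmem

/-- Every L_{I,𝒱} is all of L, which reduces the non-singular case to condition (P). -/
theorem IsPrimitive.isGlobalType (h𝒱 : 𝒱.IsPrimitive) (hns : Δ.IsNonsingular) :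
    𝒱.IsGlobalType := by
  intro I hI
  have h : ∀ J ∈ Δ.top, 𝒱.lattice J = ⊤ := fun J hJ => IsPrimitive.lattice_eq_top 𝒱 h𝒱 hns hJ
  rw [h I hI, commonLattice, eq_comm, iInf₂_eq_top]
  exact h

end EdgeVectors

end SimplicialMultiFan

end

theorem mainTheorem1 {L : Type*} [AddCommGroup L] [Module.Free ℤ L] [Module.Finite ℤ L]
    {V : Type*} [Fintype V] [DecidableEq V]
    (hL : 0 < Module.finrank ℤ L)
    (Δ : SimplicialMultiFan L V) (hΔ : Δ.IsComplete)
    (N : ℕ) (hN : 1 < N)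
    (σ : ℂ) (hσN : Complex.exp (2 * Real.pi * Complex.I * σ) ^ N = 1)
    (hσ : Complex.exp (2 * Real.pi * Complex.I * σ) ≠ 1) :
    (∀ 𝒱 : Δ.EdgeVectors, 𝒱.IsGlobalType → 𝒱.FirstChernDivisible N →
      𝒱.EllipticGenusVanishes σ) ∧
    (Δ.IsNonsingular → ∀ 𝒱 : Δ.EdgeVectors, 𝒱.IsPrimitive → 𝒱.FirstChernDivisible N →
      𝒱.EllipticGenusVanishes σ) := by
  have hN0 : N ≠ 0 := by omega
  refine ⟨fun 𝒱 h𝒱 hc => 𝒱.ellipticGenusVanishes hL hΔ hN0 hσN hσ h𝒱 hc,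
    fun hns 𝒱 hp hc => ?_⟩
  exact 𝒱.ellipticGenusVanishes hL hΔ hN0 hσN hσ
    (SimplicialMultiFan.EdgeVectors.IsPrimitive.isGlobalType 𝒱 hp hns) hc
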